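/- **Conventions.** Let $\mu$ (on $\Omega$) and $\nu$ (on $\Omega'$) be σ-finite complete measures, and let $L_0(\mu)$ be the space of $\mu$-a.e. equivalence classes of real-valued measurable functions on $\Omega$. A *quasi Banach function space* $X=X(\mu)$ is a linear subspace of $L_0(\mu)$ with a complete quasi norm $\|\cdot\|_X$ such that (I) if $x\in L_0(\mu)$, $y\in X$ and $|x|\le|y|$ a.e., then $x\in X$ and $\|x\|_X\le\|y\|_X$; (II) for some $0<t<\infty$, $\big\|(|x|^t+|y|^t)^{1/t}\big\|_X\le(\|x\|_X^t+\|y\|_X^t)^{1/t}$ for all $x,y\in X$; (III) the support of $X$ is all of $\Omega$ (a measurable set on which every $x\in X$ vanishes a.e. is a null set), and $\|x_n\|_X\to\|x\|_X$ whenever $x_n,x\in X$ and $0\le x_n\uparrow x$ a.e. $X$ is *σ-order continuous* if $\|x_n\|_X\to0$ for every sequence $(x_n)$ in $X$ with $0\le x_n\downarrow0$ a.e. For $0<r<\infty$, $X$ is *$r$-convex* if there is $c\ge0$ with $\|(\sum_k|x_k|^r)^{1/r}\|_X\le c(\sum_k\|x_k\|_X^r)^{1/r}$ for all finite families $x_1,\dots,x_n\in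 X$, and *$r$-concave* if there is $c\ge0$ with $(\sum_k\|x_k\|_X^r)^{1/r}\le c\,\|(\sum_k|x_k|^r)^{1/r}\|_X$ for all such families; the best constants are denoted by $M^{(r)}(X)$ and $M_{(r)}(X)$ respectively. For a (real or complex) quasi Banach space $E$, let $X(\mu,E)$ be the set of a.e. equivalence classes of strongly $\mu$-measurable functions $x:\Omega\to E$ with $\|x\|_E:=\|x(\cdot)\|_E\in X$. A map $T$ is *homogeneous* if $T(\lambda x)=\lambda T(x)$ for all $\lambda\ge0$ and all $x$ (no additivity is required). In the quotient below, $0/0=0$ and $a/0=\infty$ for $a>0$. **Statement.** Let $0<r<\infty$, let $E,F$ be quasi Banach spaces, let $X(\mu)$ be an $r$-convex and σ-order continuous quasi Banach function space, and let $Y(\nu)$ be an $r$-concave quasi Banach function space. Let $T:X(\mu,E)\to Y(\nu,F)$ be a homogeneous map such that for all $n$ and all $x_1,\dots,x_n\in X(\mu,E)$ $$\Big\|\Big(\sum_{k=1}^n\|Tx_k\|_F^r\Big)^{1/r}\Big\|_Y\le\Big\|\Big(\sum_{k=1}^n\|x_k\|_E^r\Big)^{1/r}\Big\|_X .$$ Then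 there are weights $0\le\omega_1\in L_0(\mu)$ and $0\le\omega_2\in L_0(\nu)$ with $$\sup_{\|x\|_X\le1}\big\|\omega_1^{1/r}x\big\|_{L_r(\mu)}\le M^{(r)}(X),\qquad \sup_{\|y\|_{L_r(\nu)}\le1}\big\|\omega_2^{1/r}y\big\|_Y\le M_{(r)}(Y)$$ (in particular $\omega_2^{1/r}y\in Y$ for all $y\in L_r(\nu)$) such that for all $x\in X(\mu,E)$ $$\int\frac{\|Tx\|_F^r}{\omega_2}\,d\nu\le\int\|x\|_E^r\,\omega_1\,d\mu .$$ -/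

import Mathlib

open MeasureTheory Filter Topology
open scoped ENNReal NNReal

/-- A complete quasi norm on the topological vector space `E` over `𝕜 = ℝ` or `ℂ`
which induces the topology of `E`; thus `E` is a quasi Banach space. -/
structure QuasiBanachNorm (𝕜 E : Type*) [RCLike 𝕜] [AddCommGroup E] [Module 𝕜 E]
    [TopologicalSpace E] where
  toFun : E → ℝ
  nonneg : ∀ x, 0 ≤ toFun x
  eq_zero_iff : ∀ x, toFun x = 0 ↔ x = 0
  smul : ∀ (c : 𝕜) (x : E), toFun (c • x) = ‖c‖ * toFun x
  exists_add_le : ∃ K : ℝ, ∀ x y, toFun (x + y) ≤ K * (toFun x + toFun y)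
  nhds_basis : ∀ x : E,
    (𝓝 x).HasBasis (fun ε : ℝ => 0 < ε) (fun ε => {y | toFun (y - x) < ε})
  complete : ∀ u : ℕ → E,
    (∀ ε : ℝ, 0 < ε → ∃ N : ℕ, ∀ m ≥ N, ∀ n ≥ N, toFun (u m - u n) < ε) →
      ∃ x, Tendsto (fun n => toFun (u n - x)) atTop (𝓝 0)

instance {𝕜 E : Type*} [RCLike 𝕜] [AddCommGroup E] [Module 𝕜 E] [TopologicalSpace E] :
    CoeFun (QuasiBanachNorm 𝕜 E) (fun _ => E → ℝ) :=
  ⟨QuasiBanachNorm.toFun⟩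

/-- A quasi Köthe function space over `μ`: a quasi normed space of (classes of) real valued
measurable functions. -/
structure QuasiKotheSpace {Ω : Type*} [MeasurableSpace Ω] (μ : Measure Ω) where
  carrier : Submodule ℝ (Ω →ₘ[μ] ℝ)
  qnorm : carrier → ℝ
  qnorm_nonneg : ∀ x, 0 ≤ qnorm x
  qnorm_eq_zero_iff : ∀ x, qnorm x = 0 ↔ x = 0
  qnorm_smul : ∀ (c : ℝ) (x : carrier), qnorm (c • x) = |c| * qnorm x
  exists_qnorm_add_le : ∃ K : ℝ, ∀ x y, qnorm (x + y) ≤ K * (qnorm x + qnorm y)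
  /-- the lattice condition -/
  solid : ∀ (x : Ω →ₘ[μ] ℝ) (y : carrier),
    (∀ᵐ ω ∂μ, |x ω| ≤ |(y : Ω →ₘ[μ] ℝ) ω|) →
      ∃ hx : x ∈ carrier, qnorm ⟨x, hx⟩ ≤ qnorm y
  /-- `‖(|x|^t + |y|^t)^{1/t}‖ ≤ (‖x‖^t + ‖y‖^t)^{1/t}` for some `0 < t < ∞`; the function on
  the left (called `z`) belongs to the space by the lattice condition -/
  exists_power_triangle : ∃ t : ℝ, 0 < t ∧ ∀ x y z : carrier,
    (∀ᵐ ω ∂μ, (z : Ω →ₘ[μ] ℝ) ω =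
      (|(x : Ω →ₘ[μ] ℝ) ω| ^ t + |(y : Ω →ₘ[μ] ℝ) ω| ^ t) ^ (1 / t)) →
      qnorm z ≤ (qnorm x ^ t + qnorm y ^ t) ^ (1 / t)
  /-- the support of the space is all of `Ω`, up to null sets -/
  full_support : ∀ A : Set Ω, MeasurableSet A →
    (∀ x : carrier, ∀ᵐ ω ∂μ, ω ∈ A → (x : Ω →ₘ[μ] ℝ) ω = 0) → μ A = 0
  /-- the Fatou property -/
  fatou : ∀ (x : ℕ → carrier) (y : carrier),
    (∀ᵐ ω ∂μ, (∀ n, 0 ≤ (x n : Ω →ₘ[μ] ℝ) ω) ∧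
      Monotone (fun n => (x n : Ω →ₘ[μ] ℝ) ω) ∧
      Tendsto (fun n => (x n : Ω →ₘ[μ] ℝ) ω) atTop (𝓝 ((y : Ω →ₘ[μ] ℝ) ω))) →
    Tendsto (fun n => qnorm (x n)) atTop (𝓝 (qnorm y))

/-- A quasi Banach function space is a complete quasi Köthe function space. -/
structure QuasiBanachFunctionSpace {Ω : Type*} [MeasurableSpace Ω] (μ : Measure Ω) extends
    QuasiKotheSpace μ where
  complete : ∀ u : ℕ → carrier,
    (∀ ε : ℝ, 0 < ε → ∃ N : ℕ, ∀ m ≥ N, ∀ n ≥ N, qnorm (u m - u n) < ε) →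
      ∃ x, Tendsto (fun n => qnorm (u n - x)) atTop (𝓝 0)

namespace QuasiKotheSpace

variable {Ω : Type*} [MeasurableSpace Ω] {μ : Measure Ω}

/-- The function `f` is (a.e. equal to a) measurable (function) and its class belongs to `X`. -/
def Mem (X : QuasiKotheSpace μ) (f : Ω → ℝ) : Prop :=
  ∃ h : AEStronglyMeasurable f μ, AEEqFun.mk f h ∈ X.carrier

open Classical in
/-- The quasi norm of `X` on functions, with the value `∞` on functions outside `X`. -/
noncomputable def eNorm (X : QuasiKotheSpace μ) (f : Ω → ℝ) : ℝ≥0∞ :=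
  if h : X.Mem f then ENNReal.ofReal (X.qnorm ⟨AEEqFun.mk f h.fst, h.snd⟩) else ∞

/-- `X` is `r`-convex with constant `c`. -/
def ConvexWith (X : QuasiKotheSpace μ) (r : ℝ) (c : ℝ≥0) : Prop :=
  ∀ (n : ℕ) (x : Fin n → X.carrier),
    X.eNorm (fun ω => (∑ k, |(x k : Ω →ₘ[μ] ℝ) ω| ^ r) ^ (1 / r)) ≤
      c * (∑ k, ENNReal.ofReal (X.qnorm (x k)) ^ r) ^ (1 / r)

/-- `X` is `r`-concave with constant `c`. -/
def ConcaveWith (X : QuasiKotheSpace μ) (r : ℝ) (c : ℝ≥0) : Prop :=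
  ∀ (n : ℕ) (x : Fin n → X.carrier),
    (∑ k, ENNReal.ofReal (X.qnorm (x k)) ^ r) ^ (1 / r) ≤
      c * X.eNorm (fun ω => (∑ k, |(x k : Ω →ₘ[μ] ℝ) ω| ^ r) ^ (1 / r))

/-- `r`-convexity. -/
def IsRConvex (X : QuasiKotheSpace μ) (r : ℝ) : Prop := ∃ c : ℝ≥0, X.ConvexWith r c

/-- `r`-concavity. -/
def IsRConcave (X : QuasiKotheSpace μ) (r : ℝ) : Prop := ∃ c : ℝ≥0, X.ConcaveWith r c

/-- The best constant in the definition of `r`-convexity, `∞` if `X` is not `r`-convex. -/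
noncomputable def convexityConst (X : QuasiKotheSpace μ) (r : ℝ) : ℝ≥0∞ :=
  ⨅ (c : ℝ≥0) (_ : X.ConvexWith r c), (c : ℝ≥0∞)

/-- The best constant in the definition of `r`-concavity, `∞` if `X` is not `r`-concave. -/
noncomputable def concavityConst (X : QuasiKotheSpace μ) (r : ℝ) : ℝ≥0∞ :=
  ⨅ (c : ℝ≥0) (_ : X.ConcaveWith r c), (c : ℝ≥0∞)

/-- σ-order continuity: `‖xₙ‖ → 0` whenever `0 ≤ xₙ ↓ 0` almost everywhere. -/
def IsSigmaOrderContinuous (X : QuasiKotheSpace μ) : Prop :=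
  ∀ x : ℕ → X.carrier,
    (∀ᵐ ω ∂μ, (∀ n, 0 ≤ (x n : Ω →ₘ[μ] ℝ) ω) ∧
      Antitone (fun n => (x n : Ω →ₘ[μ] ℝ) ω) ∧
      Tendsto (fun n => (x n : Ω →ₘ[μ] ℝ) ω) atTop (𝓝 0)) →
    Tendsto (fun n => X.qnorm (x n)) atTop (𝓝 0)

variable {𝕜 E : Type*} [RCLike 𝕜] [AddCommGroup E] [Module 𝕜 E] [TopologicalSpace E]

/-- The vector valued function space `X(μ, E)`: all (classes of) strongly measurable functions
`x : Ω → E` such that `‖x(·)‖_E` belongs to `X`. -/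
def vectorValued (X : QuasiKotheSpace μ) (N : QuasiBanachNorm 𝕜 E) : Set (Ω →ₘ[μ] E) :=
  {x | X.Mem (fun ω => N (x ω))}

theorem smul_mem_vectorValued [ContinuousSMul 𝕜 E] (X : QuasiKotheSpace μ)
    (N : QuasiBanachNorm 𝕜 E) (c : 𝕜) {x : Ω →ₘ[μ] E} (hx : x ∈ X.vectorValued N) :
    c • x ∈ X.vectorValued N := by
  obtain ⟨h, hm⟩ := hx
  have e : (fun ω => N ((c • x : Ω →ₘ[μ] E) ω)) =ᵐ[μ] fun ω => ‖c‖ * N (x ω) := by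
    filter_upwards [AEEqFun.coeFn_smul c x] with ω hω
    rw [hω, Pi.smul_apply, N.smul]
  refine ⟨(h.const_mul ‖c‖).congr e.symm, ?_⟩
  convert X.carrier.smul_mem ‖c‖ hm using 1
  refine AEEqFun.ext ?_
  filter_upwards [AEEqFun.coeFn_mk _ ((h.const_mul ‖c‖).congr e.symm), e,
    AEEqFun.coeFn_smul ‖c‖ (AEEqFun.mk _ h), AEEqFun.coeFn_mk _ h] with ω h1 h2 h3 h4
  rw [h1, h2, h3, Pi.smul_apply, h4, smul_eq_mul]

/-- Multiplication by scalars `c ≥ 0` in `X(μ, E)`. -/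
def scale [ContinuousSMul 𝕜 E] (X : QuasiKotheSpace μ) (N : QuasiBanachNorm 𝕜 E) (c : ℝ≥0)
    (x : X.vectorValued N) : X.vectorValued N :=
  ⟨((c : ℝ) : 𝕜) • (x : Ω →ₘ[μ] E), X.smul_mem_vectorValued N _ x.2⟩

end QuasiKotheSpace

/-! Write p_X(f) = ‖f^{1/r}‖_X^r for f ≥ 0 (`powNorm`), similarly p_Y, and let M, N be the best
convexity and concavity constants. Then p_X is subadditive up to the factor M^r and p_Y is
superadditive up to N^r. Homogeneity of T and the vector valued inequality say that every pair (f,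
g) in the cone R generated by the pairs (‖x‖^r, ‖Tx‖^r) satisfies p_Y(g) ≤ p_X(f). Hence, for N > 0,
whenever ∑ s_j ≤ g and f ≤ ∑ f_i, N^{-r} ∑ p_Y(s_j) ≤ p_Y(g) ≤ p_X(f) ≤ M^r ∑ p_X(f_i). Both weights
come from linearising this chain with a Hahn-Banach sandwich (`exists_additive_between`), used
twice.

The first sandwich, on X, gives an additive ψ ≤ M^r p_X with ψ(f) ≥ N^{-r} ∑ p_Y(s_j). The second,
on Y, gives an additive ψ' with N^{-r} p_Y ≤ ψ' and ψ'(g) ≤ ∫ f ω₁ for (f, g) in R. Additivity on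
cones replaces any linearity of T.

The functionals are only finitely additive, so each is replaced by its countably additive part,
which has a density (`exists_density`). This part lies below ψ, so upper bounds survive. Lower
bounds survive because every f is an increasing limit of functions on which ψ exceeds the integral
of f by at most ε (`exists_cover_le`, in the spirit of Yosida-Hewitt). In X, σ-order continuity
makes ψ small on the remainders; in Y, the Fatou property of p_Y suffices.

The weight ω₂ is the reciprocal of the second density v. That ω₂^{1/r} y belongs to Y for y in L_r
needs completeness of Y, through a Riesz-Fischer argument (`powNorm_ne_top_of_tendsto`). -/

/-! ### Hahn-Banach sandwich theorem for cones of nonnegative functions -/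

/-- A linear functional below the gauge of a cone in `E × ℝ`. -/
theorem exists_linearMap_le_of_cone {E : Type*} [AddCommGroup E] [Module ℝ E]
    (C : PointedCone ℝ (E × ℝ)) (h0 : ∀ β : ℝ, ((0 : E), β) ∈ C → 0 ≤ β)
    (htot : ∀ a : E, ∃ β : ℝ, (a, β) ∈ C) :
    ∃ φ : E →ₗ[ℝ] ℝ, ∀ x ∈ C, φ x.1 ≤ x.2 := by
  let d : Submodule ℝ (E × ℝ) := Submodule.prod ⊥ ⊤
  -- M. Riesz extension of (0, β) ↦ β from {0} × ℝ to a functional g that is nonnegative on the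
  -- cone. Since g(a, β) = g(a, 0) + β, positivity is the claim for φ(a) = -g(a, 0).
  obtain ⟨g, hg, hpos⟩ := riesz_extension C ⟨d, (LinearMap.snd ℝ E ℝ).domRestrict d⟩
    (by
      rintro ⟨⟨a, β⟩, hx⟩ hC
      have ha : a = 0 := by simpa [d] using hx
      subst ha
      simpa using h0 β hC)
    (by
      rintro ⟨a, t⟩
      obtain ⟨β, hβ⟩ := htot a
      exact ⟨⟨(0, β - t), by simp [d]⟩, by simpa using hβ⟩)
  refine ⟨-(g.comp (LinearMap.inl ℝ E ℝ)), ?_⟩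
  rintro ⟨a, β⟩ hx
  have h1 : g (0, β) = β := hg ⟨(0, β), by simp [d]⟩
  have h2 := hpos _ hx
  have h3 : ((a, β) : E × ℝ) = (a, 0) + (0, β) := by simp
  rw [h3, map_add, h1] at h2
  simp only [LinearMap.neg_apply, LinearMap.coe_comp, Function.comp_apply, LinearMap.inl_apply]
  linarith

/-- Measurable functions dominated almost everywhere by an element of the cone `U`. -/
def Dominated {Ω : Type*} [MeasurableSpace Ω] (μ : Measure Ω)
    (U : Submodule ℝ≥0 ((Ω → ℝ≥0) × ℝ≥0)) (f : Ω → ℝ≥0) : Prop :=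
  Measurable f ∧ ∃ u ∈ U, f ≤ᵐ[μ] u.1

section sandwich

variable {Ω : Type*} [MeasurableSpace Ω] {μ : Measure Ω}
  {U L : Submodule ℝ≥0 ((Ω → ℝ≥0) × ℝ≥0)}

theorem Dominated.add {f g : Ω → ℝ≥0} (hf : Dominated μ U f) (hg : Dominated μ U g) :
    Dominated μ U (f + g) := by
  obtain ⟨mf, u, hu, hfu⟩ := hf
  obtain ⟨mg, v, hv, hgv⟩ := hg
  refine ⟨mf.add mg, u + v, U.add_mem hu hv, ?_⟩
  filter_upwards [hfu, hgv] with ω h1 h2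
  exact add_le_add h1 h2

theorem Dominated.smul {f : Ω → ℝ≥0} (c : ℝ≥0) (hf : Dominated μ U f) :
    Dominated μ U (c • f) := by
  obtain ⟨mf, u, hu, hfu⟩ := hf
  refine ⟨mf.const_smul c, c • u, U.smul_mem c hu, ?_⟩
  filter_upwards [hfu] with ω h1
  exact mul_le_mul_right h1 c

theorem Dominated.mono {f g : Ω → ℝ≥0} (hg : Dominated μ U g) (hf : Measurable f)
    (h : f ≤ᵐ[μ] g) : Dominated μ U f := by
  obtain ⟨-, u, hu, hgu⟩ := hg
  exact ⟨hf, u, hu, h.trans hgu⟩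

theorem Dominated.zero : Dominated μ U 0 :=
  ⟨measurable_const, 0, U.zero_mem, by rfl⟩

/-- Real valued measurable functions dominated almost everywhere by an element of `U`. -/
def dominatedSubmodule (μ : Measure Ω) (U : Submodule ℝ≥0 ((Ω → ℝ≥0) × ℝ≥0)) :
    Submodule ℝ (Ω → ℝ) where
  carrier := {a | Measurable a ∧ ∃ u ∈ U, ∀ᵐ ω ∂μ, |a ω| ≤ u.1 ω}
  zero_mem' := ⟨measurable_const, 0, U.zero_mem, by simp⟩
  add_mem' := by
    rintro a b ⟨ma, u, hu, h⟩ ⟨mb, v, hv, h'⟩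
    refine ⟨ma.add mb, u + v, U.add_mem hu hv, ?_⟩
    filter_upwards [h, h'] with ω h1 h2
    simpa using (abs_add_le _ _).trans (add_le_add h1 h2)
  smul_mem' := by
    rintro c a ⟨ma, u, hu, h⟩
    refine ⟨ma.const_smul c, ‖c‖₊ • u, U.smul_mem _ hu, ?_⟩
    filter_upwards [h] with ω h1
    simpa [abs_mul] using mul_le_mul_of_nonneg_left h1 (abs_nonneg c)

/-- The cone of all `(a, β)` for which a functional between `L` and `U` has to be at most `β`
at `a`. -/
def sandwichCone (μ : Measure Ω) (U L : Submodule ℝ≥0 ((Ω → ℝ≥0) × ℝ≥0)) :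
    PointedCone ℝ (dominatedSubmodule μ U × ℝ) where
  carrier := {x | ∃ u ∈ U, ∃ l ∈ L,
    (∀ᵐ ω ∂μ, (x.1 : Ω → ℝ) ω + l.1 ω ≤ u.1 ω) ∧ (u.2 : ℝ) - l.2 ≤ x.2}
  zero_mem' := ⟨0, U.zero_mem, 0, L.zero_mem, by simp, by simp⟩
  add_mem' := by
    rintro x y ⟨u, hu, l, hl, h, h2⟩ ⟨u', hu', l', hl', h', h2'⟩
    refine ⟨u + u', U.add_mem hu hu', l + l', L.add_mem hl hl', ?_, ?_⟩
    · filter_upwards [h, h'] with ω h1 h2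
      simp
      linarith
    · simp
      linarith
  smul_mem' := by
    rintro ⟨c, hc⟩ x ⟨u, hu, l, hl, h, h2⟩
    obtain ⟨d, rfl⟩ : ∃ d : ℝ≥0, (d : ℝ) = c := ⟨⟨c, hc⟩, rfl⟩
    refine ⟨d • u, U.smul_mem _ hu, d • l, L.smul_mem _ hl, ?_, ?_⟩
    · filter_upwards [h] with ω h1
      have := mul_le_mul_of_nonneg_left h1 hc
      change d * (x.1 : Ω → ℝ) ω + d * l.1 ω ≤ d * u.1 ω
      linarith
    · have := mul_le_mul_of_nonneg_left h2 hc
      change d * (u.2 : ℝ) - d * l.2 ≤ d * x.2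
      linarith

/-- The sandwich theorem for cones of nonnegative functions. -/
theorem exists_additive_between (hU : ∀ u ∈ U, Measurable u.1)
    (hLU : ∀ l ∈ L, ∀ u ∈ U, l.1 ≤ᵐ[μ] u.1 → l.2 ≤ u.2) :
    ∃ ψ : (Ω → ℝ≥0) → ℝ≥0,
      (∀ f g, Dominated μ U f → Dominated μ U g → ψ (f + g) = ψ f + ψ g) ∧
      (∀ (c : ℝ≥0) f, Dominated μ U f → ψ (c • f) = c * ψ f) ∧
      (∀ f g, Dominated μ U f → Dominated μ U g → f ≤ᵐ[μ] g → ψ f ≤ ψ g) ∧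
      (∀ u ∈ U, ψ u.1 ≤ u.2) ∧
      (∀ l ∈ L, Dominated μ U l.1 → l.2 ≤ ψ l.1) := by
  classical
  -- At a = 0 the cone condition reads l ≤ u a.e., so `hLU` gives β ≥ 0. All properties of φ come
  -- from special members of the cone: u = l = 0 gives monotonicity, l = 0 the upper bound, u = 0
  -- the lower bound.
  obtain ⟨φ, hφ⟩ := exists_linearMap_le_of_cone (sandwichCone μ U L)
    (by
      rintro β ⟨u, hu, l, hl, h, h2⟩
      have : l.2 ≤ u.2 := hLU l hl u hu (by
        filter_upwards [h] with ω h1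
        simpa using h1)
      have : (l.2 : ℝ) ≤ u.2 := by exact_mod_cast this
      simp only at h2
      linarith)
    (by
      rintro ⟨a, ma, u, hu, h⟩
      refine ⟨u.2, u, hu, 0, L.zero_mem, ?_, by simp⟩
      filter_upwards [h] with ω h1
      simpa using (le_abs_self _).trans h1)
  have hmem : ∀ f, Dominated μ U f → (fun ω => (f ω : ℝ)) ∈ dominatedSubmodule μ U := by
    rintro f ⟨mf, u, hu, h⟩
    refine ⟨mf.coe_nnreal_real, u, hu, ?_⟩
    filter_upwards [h] with ω h1
    simpa using h1
  have hneg : ∀ a : dominatedSubmodule μ U, (∀ᵐ ω ∂μ, (a : Ω → ℝ) ω ≤ 0) → φ a ≤ 0 := by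
    intro a ha
    refine hφ (a, 0) ⟨0, U.zero_mem, 0, L.zero_mem, ?_, by simp⟩
    filter_upwards [ha] with ω h
    simpa using h
  have hpos : ∀ f (h : Dominated μ U f), 0 ≤ φ ⟨_, hmem f h⟩ := by
    intro f h
    have := hneg (-⟨_, hmem f h⟩) (ae_of_all _ fun ω => by simp)
    rw [map_neg] at this
    linarith
  -- The default value 0 never matters, since every assertion concerns dominated functions; there φ
  -- ≥ 0 and the truncation is harmless.
  let ψ : (Ω → ℝ≥0) → ℝ≥0 := fun f => if h : Dominated μ U f then (φ ⟨_, hmem f h⟩).toNNReal else 0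
  have hψ : ∀ f (h : Dominated μ U f), (ψ f : ℝ) = φ ⟨_, hmem f h⟩ := by
    intro f h
    simp only [ψ, dif_pos h, Real.coe_toNNReal _ (hpos f h)]
  refine ⟨ψ, ?_, ?_, ?_, ?_, ?_⟩
  · intro f g hf hg
    rw [← NNReal.coe_inj, NNReal.coe_add, hψ _ hf, hψ _ hg, hψ _ (hf.add hg), ← map_add]
    congr 1
  · intro c f hf
    rw [← NNReal.coe_inj, NNReal.coe_mul, hψ _ hf, hψ _ (hf.smul c), ← smul_eq_mul, ← map_smul]
    congr 1
  · intro f g hf hg hfg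
    rw [← NNReal.coe_le_coe, hψ _ hf, hψ _ hg, ← sub_nonpos, ← map_sub]
    refine hneg _ ?_
    filter_upwards [hfg] with ω h
    simpa using h
  · intro u hu
    have hd : Dominated μ U u.1 := ⟨hU u hu, u, hu, by rfl⟩
    rw [← NNReal.coe_le_coe, hψ _ hd]
    exact hφ (_, _) ⟨u, hu, 0, L.zero_mem, by simp, by simp⟩
  · intro l hl hd
    rw [← NNReal.coe_le_coe, hψ _ hd]
    have := hφ (-⟨_, hmem _ hd⟩, -(l.2 : ℝ)) ⟨0, U.zero_mem, l, hl, by simp, by simp⟩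
    rw [map_neg] at this
    simp only at this
    linarith

end sandwich

/-! ### Countably additive part of a positive functional and its density -/

/-- Additive, homogeneous and monotone functionals on the functions dominated by `U`. -/
structure IsPositiveOn {Ω : Type*} [MeasurableSpace Ω] (μ : Measure Ω)
    (U : Submodule ℝ≥0 ((Ω → ℝ≥0) × ℝ≥0)) (ψ : (Ω → ℝ≥0) → ℝ≥0) : Prop where
  add : ∀ f g, Dominated μ U f → Dominated μ U g → ψ (f + g) = ψ f + ψ g
  smul : ∀ (c : ℝ≥0) f, Dominated μ U f → ψ (c • f) = c * ψ f
  mono : ∀ f g, Dominated μ U f → Dominated μ U g → f ≤ᵐ[μ] g → ψ f ≤ ψ g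

section representation

variable {Ω : Type*} [MeasurableSpace Ω] {μ : Measure Ω}
  {U : Submodule ℝ≥0 ((Ω → ℝ≥0) × ℝ≥0)} {ψ : (Ω → ℝ≥0) → ℝ≥0}

theorem IsPositiveOn.map_zero (hψ : IsPositiveOn μ U ψ) : ψ 0 = 0 := by
  simpa using hψ.smul 0 0 Dominated.zero

theorem Dominated.sum {ι : Type*} (s : Finset ι) {f : ι → Ω → ℝ≥0}
    (hf : ∀ i ∈ s, Dominated μ U (f i)) : Dominated μ U (∑ i ∈ s, f i) := by
  classical
  induction s using Finset.induction_on with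
  | empty => simpa using Dominated.zero
  | insert a s ha ih =>
    rw [Finset.sum_insert ha]
    exact (hf a (by simp)).add (ih fun i hi => hf i (by simp [hi]))

theorem IsPositiveOn.map_sum (hψ : IsPositiveOn μ U ψ) {ι : Type*} (s : Finset ι)
    {f : ι → Ω → ℝ≥0} (hf : ∀ i ∈ s, Dominated μ U (f i)) :
    ψ (∑ i ∈ s, f i) = ∑ i ∈ s, ψ (f i) := by
  classical
  induction s using Finset.induction_on with
  | empty => simpa using hψ.map_zero
  | insert a s ha ih =>
    rw [Finset.sum_insert ha, Finset.sum_insert ha,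
      hψ.add _ _ (hf a (by simp)) (Dominated.sum s fun i hi => hf i (by simp [hi])),
      ih fun i hi => hf i (by simp [hi])]

theorem Dominated.indicator_subset {A B : Set Ω} (hB : Dominated μ U (B.indicator 1))
    (hA : MeasurableSet A) (h : A ⊆ B) : Dominated μ U (A.indicator 1) :=
  hB.mono (measurable_const.indicator hA)
    (ae_of_all _ fun ω => Set.indicator_le_indicator_of_subset h (fun _ => zero_le) ω)

theorem indicator_union_le_add {Ω : Type*} (A B : Set Ω) :
    (A ∪ B).indicator (1 : Ω → ℝ≥0) ≤ A.indicator 1 + B.indicator 1 := by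
  intro ω
  by_cases h1 : ω ∈ A <;> by_cases h2 : ω ∈ B <;> simp [h1, h2]

theorem Dominated.indicator_union {A B : Set Ω} (hA : MeasurableSet A) (hB : MeasurableSet B)
    (h1 : Dominated μ U (A.indicator 1)) (h2 : Dominated μ U (B.indicator 1)) :
    Dominated μ U ((A ∪ B).indicator 1) :=
  (h1.add h2).mono (measurable_const.indicator (hA.union hB))
    (ae_of_all _ (indicator_union_le_add A B))

/-- A solid cone of measurable functions over an s-finite measure has a support, which is
exhausted by sets whose indicators belong to the cone. -/
theorem exists_exhausting_sets [SFinite μ] (U : Submodule ℝ≥0 ((Ω → ℝ≥0) × ℝ≥0)) :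
    ∃ B : ℕ → Set Ω, Monotone B ∧ (∀ n, MeasurableSet (B n)) ∧
      (∀ n, Dominated μ U ((B n).indicator 1)) ∧
      ∀ f, Dominated μ U f → ∀ᵐ ω ∂μ, ω ∉ ⋃ n, B n → f ω = 0 := by
  -- Exhaustion with respect to a finite measure having the same null sets: the sets A n nearly
  -- maximise P among the sets with dominated indicator.
  let P := μ.toFinite
  let R : Set (Set Ω) := {A | MeasurableSet A ∧ Dominated μ U (A.indicator 1)}
  have hR0 : ∅ ∈ R := ⟨MeasurableSet.empty, by simpa only [Set.indicator_empty'] using Dominated.zero⟩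
  obtain ⟨a, -, ha, haR⟩ := exists_seq_tendsto_sSup (S := P '' R) ⟨_, Set.mem_image_of_mem _ hR0⟩
    (OrderTop.bddAbove _)
  choose A hAR hA using haR
  have hacc : ∀ n, Set.accumulate A n ∈ R := by
    intro n
    induction n with
    | zero => simpa [Set.accumulate_zero_nat] using hAR 0
    | succ n ih =>
      rw [Set.accumulate_succ]
      exact ⟨ih.1.union (hAR _).1, Dominated.indicator_union ih.1 (hAR _).1 ih.2 (hAR _).2⟩
  refine ⟨Set.accumulate A, Set.monotone_accumulate, fun n => (hacc n).1, fun n => (hacc n).2, ?_⟩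
  intro f hf
  rw [Set.iUnion_accumulate]
  have hAm : MeasurableSet (⋃ n, A n) := MeasurableSet.iUnion fun n => (hAR n).1
  have hsup : sSup (P '' R) ≤ P (⋃ n, A n) :=
    le_of_tendsto ha (Eventually.of_forall fun n => by
      rw [← hA]
      exact measure_mono (Set.subset_iUnion A n))
  have key : ∀ k : ℕ, μ ({ω | f ω ≥ 1 / ((k : ℝ≥0) + 1)} \ ⋃ n, A n) = 0 := by
    intro k
    set E := {ω | f ω ≥ 1 / ((k : ℝ≥0) + 1)} \ ⋃ n, A n with hE
    have hEm : MeasurableSet E := (measurableSet_le measurable_const hf.1).diff hAm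
    -- On E one has 1 ≤ (k + 1) f, so E itself competes in the supremum; being disjoint from every A
    -- n, it must be P-null.
    have hER : E ∈ R := by
      refine ⟨hEm, (hf.smul ((k : ℝ≥0) + 1)).mono (measurable_const.indicator hEm)
        (ae_of_all _ fun ω => ?_)⟩
      by_cases h : ω ∈ E
      · have h1 : 1 / ((k : ℝ≥0) + 1) ≤ f ω := h.1
        rw [div_le_iff₀ (by positivity)] at h1
        simpa [h, mul_comm] using h1
      · simp [h]
    have h1 : ∀ n, a n + P E ≤ sSup (P '' R) := by
      intro n
      rw [← hA, ← measure_union _ hEm]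
      · exact le_sSup (Set.mem_image_of_mem _ ⟨(hAR n).1.union hEm,
          Dominated.indicator_union (hAR n).1 hEm (hAR n).2 hER.2⟩)
      · exact Set.disjoint_left.2 fun ω h1 h2 => h2.2 (Set.mem_iUnion.2 ⟨n, h1⟩)
    have h2 : sSup (P '' R) + P E ≤ sSup (P '' R) :=
      le_of_tendsto' (ha.add tendsto_const_nhds) h1
    have h3 : sSup (P '' R) ≠ ∞ := (hsup.trans_lt (measure_lt_top P _)).ne
    have h4 : P E = 0 := by
      have : sSup (P '' R) + P E ≤ sSup (P '' R) + 0 := by simpa using h2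
      exact le_antisymm ((ENNReal.add_le_add_iff_left h3).1 this) zero_le
    exact absolutelyContinuous_toFinite μ h4
  have : μ (⋃ k : ℕ, {ω | f ω ≥ 1 / ((k : ℝ≥0) + 1)} \ ⋃ n, A n) = 0 := measure_iUnion_null key
  filter_upwards [measure_eq_zero_iff_ae_notMem.1 this] with ω hω hn
  by_contra h
  apply hω
  obtain ⟨k, hk⟩ := exists_nat_one_div_lt (pos_iff_ne_zero.2 h)
  exact Set.mem_iUnion.2 ⟨k, hk.le, hn⟩

open Classical in
/-- The values of `ψ` on indicators, `∞` if the indicator is not dominated by `U`. -/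
noncomputable def indicatorContent (μ : Measure Ω) (U : Submodule ℝ≥0 ((Ω → ℝ≥0) × ℝ≥0))
    (ψ : (Ω → ℝ≥0) → ℝ≥0) (A : Set Ω) : ℝ≥0∞ :=
  if MeasurableSet A ∧ Dominated μ U (A.indicator 1) then (ψ (A.indicator 1) : ℝ≥0∞) else ∞

theorem indicatorContent_of_dominated {A : Set Ω} (hA : MeasurableSet A)
    (h : Dominated μ U (A.indicator 1)) :
    indicatorContent μ U ψ A = ψ (A.indicator 1) :=
  if_pos ⟨hA, h⟩

theorem indicatorContent_empty (hψ : IsPositiveOn μ U ψ) : indicatorContent μ U ψ ∅ = 0 := by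
  rw [indicatorContent_of_dominated MeasurableSet.empty
    (by simpa only [Set.indicator_empty'] using Dominated.zero)]
  simpa only [Set.indicator_empty', ENNReal.coe_eq_zero] using hψ.map_zero

/-- Additivity of ψ lets a measurable s split a dominated set t without loss; all other sets t have
content ∞. -/
theorem measurableSet_le_caratheodory (hψ : IsPositiveOn μ U ψ) :
    ‹MeasurableSpace Ω› ≤ (OuterMeasure.ofFunction (indicatorContent μ U ψ)
      (indicatorContent_empty hψ)).caratheodory := by
  intro s hs
  refine OuterMeasure.ofFunction_caratheodory fun t => ?_
  by_cases ht : MeasurableSet t ∧ Dominated μ U (t.indicator 1)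
  · have h1 := ht.2.indicator_subset (ht.1.inter hs) Set.inter_subset_left
    have h2 := ht.2.indicator_subset (ht.1.diff hs) Set.sdiff_subset
    rw [indicatorContent_of_dominated ht.1 ht.2, indicatorContent_of_dominated (ht.1.inter hs) h1,
      indicatorContent_of_dominated (ht.1.diff hs) h2, ← ENNReal.coe_add, ← hψ.add _ _ h1 h2]
    refine ENNReal.coe_le_coe.2 (hψ.mono _ _ (h1.add h2) ht.2 (ae_of_all _ fun ω => ?_))
    by_cases h3 : ω ∈ t <;> by_cases h4 : ω ∈ s <;> simp [h3, h4]
  · simp [indicatorContent, ht]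

/-- The countably additive part of `ψ`. -/
noncomputable def countablyAdditivePart (hψ : IsPositiveOn μ U ψ) : Measure Ω :=
  (OuterMeasure.ofFunction (indicatorContent μ U ψ) (indicatorContent_empty hψ)).toMeasure
    (measurableSet_le_caratheodory hψ)

theorem countablyAdditivePart_le (hψ : IsPositiveOn μ U ψ) {A : Set Ω} (hA : MeasurableSet A)
    (h : Dominated μ U (A.indicator 1)) :
    countablyAdditivePart hψ A ≤ ψ (A.indicator 1) := by
  rw [countablyAdditivePart, toMeasure_apply _ _ hA, ← indicatorContent_of_dominated hA h]
  exact OuterMeasure.ofFunction_le _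

/-- The indicator of a null set is a.e. at most 0, and ψ is monotone with respect to the a.e. order.
-/
theorem countablyAdditivePart_absolutelyContinuous (hψ : IsPositiveOn μ U ψ) :
    countablyAdditivePart hψ ≪ μ := by
  refine Measure.AbsolutelyContinuous.mk fun s hs h0 => ?_
  have h1 : s.indicator (1 : Ω → ℝ≥0) ≤ᵐ[μ] 0 := by
    filter_upwards [measure_eq_zero_iff_ae_notMem.1 h0] with ω hω
    simp [hω]
  have hd : Dominated μ U (s.indicator 1) :=
    Dominated.zero.mono (measurable_const.indicator hs) h1
  refine le_antisymm ((countablyAdditivePart_le hψ hs hd).trans ?_) zero_le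
  have := hψ.mono _ _ hd Dominated.zero h1
  rw [hψ.map_zero] at this
  exact_mod_cast this

/-- The outer measure of A is an infimum over countable covers. The finite partial unions of a
nearly optimal cover exhaust A, and finite subadditivity of ψ bounds its value on each of them. Thus
whatever ψ has beyond its countably additive part disappears, up to δ, along a suitable exhaustion.
-/
theorem exists_cover_le (hψ : IsPositiveOn μ U ψ) {A : Set Ω} (hA : MeasurableSet A)
    (h : Dominated μ U (A.indicator 1)) {δ : ℝ≥0∞} (hδ : δ ≠ 0) :
    ∃ t : ℕ → Set Ω, (∀ n, MeasurableSet (t n)) ∧ Monotone t ∧ (⋃ n, t n) = A ∧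
      ∀ n, (ψ ((t n).indicator 1) : ℝ≥0∞) ≤ countablyAdditivePart hψ A + δ := by
  wlog hδ' : δ ≠ ∞ generalizing δ
  · obtain ⟨t, h1, h2, h3, h4⟩ := this (δ := 1) (by simp) (by simp)
    refine ⟨t, h1, h2, h3, fun n => (h4 n).trans ?_⟩
    rw [not_ne_iff.1 hδ']
    simp
  have hfin : countablyAdditivePart hψ A ≠ ∞ :=
    ((countablyAdditivePart_le hψ hA h).trans_lt ENNReal.coe_lt_top).ne
  have hlt : countablyAdditivePart hψ A < countablyAdditivePart hψ A + δ :=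
    ENNReal.lt_add_right hfin hδ
  conv_lhs at hlt => rw [countablyAdditivePart, toMeasure_apply _ _ hA,
    OuterMeasure.ofFunction_apply]
  simp only [iInf_lt_iff] at hlt
  obtain ⟨c, hc, hsum⟩ := hlt
  -- A cover of finite total content can only use measurable sets with dominated indicator.
  have hcm : ∀ i, MeasurableSet (c i) ∧ Dominated μ U ((c i).indicator 1) := by
    intro i
    by_contra hi
    have h1 : indicatorContent μ U ψ (c i) = ∞ := if_neg hi
    have h2 := ENNReal.le_tsum (f := fun n => indicatorContent μ U ψ (c n)) i
    simp only [h1, top_le_iff] at h2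
    rw [h2] at hsum
    exact not_top_lt hsum
  refine ⟨fun n => A ∩ ⋃ i < n, c i,
    fun n => hA.inter (MeasurableSet.biUnion (Set.to_countable _) fun i _ => (hcm i).1), ?_, ?_, ?_⟩
  · intro n m hnm
    exact Set.inter_subset_inter_right _
      (Set.biUnion_subset_biUnion_left fun i hi => lt_of_lt_of_le hi hnm)
  · refine Set.Subset.antisymm (Set.iUnion_subset fun n => Set.inter_subset_left) fun ω hω => ?_
    obtain ⟨i, hi⟩ := Set.mem_iUnion.1 (hc hω)
    exact Set.mem_iUnion.2 ⟨i + 1, hω, Set.mem_biUnion (Nat.lt_succ_self i) hi⟩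
  · intro n
    have hd : Dominated μ U ((A ∩ ⋃ i < n, c i).indicator 1) :=
      h.indicator_subset
        (hA.inter (MeasurableSet.biUnion (Set.to_countable _) fun i _ => (hcm i).1))
        Set.inter_subset_left
    have h1 : ψ ((A ∩ ⋃ i < n, c i).indicator 1) ≤
        ∑ i ∈ Finset.range n, ψ ((c i).indicator 1) := by
      rw [← hψ.map_sum _ fun i _ => (hcm i).2]
      refine hψ.mono _ _ hd (Dominated.sum _ fun i _ => (hcm i).2) (ae_of_all _ fun ω => ?_)
      by_cases hω : ω ∈ A ∩ ⋃ i < n, c i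
      · obtain ⟨i, hi, hω'⟩ := Set.mem_iUnion₂.1 hω.2
        rw [Set.indicator_of_mem hω, Finset.sum_apply]
        refine le_trans ?_ (Finset.single_le_sum
          (f := fun i => (c i).indicator (1 : Ω → ℝ≥0) ω) (fun _ _ => zero_le)
          (Finset.mem_range.2 hi))
        simp [hω']
      · simp [hω]
    calc (ψ ((A ∩ ⋃ i < n, c i).indicator 1) : ℝ≥0∞)
        ≤ ∑ i ∈ Finset.range n, (ψ ((c i).indicator 1) : ℝ≥0∞) := by exact_mod_cast h1
      _ = ∑ i ∈ Finset.range n, indicatorContent μ U ψ (c i) :=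
          Finset.sum_congr rfl fun i _ =>
            (indicatorContent_of_dominated (hcm i).1 (hcm i).2).symm
      _ ≤ ∑' i, indicatorContent μ U ψ (c i) := ENNReal.sum_le_tsum _
      _ ≤ _ := hsum.le

/-- The function `f` is the limit of an increasing sequence on which `ψ` is bounded by the
integral of `f` with respect to `κ`, up to arbitrarily small errors. -/
def ApproxBelow (μ : Measure Ω) (U : Submodule ℝ≥0 ((Ω → ℝ≥0) × ℝ≥0)) (ψ : (Ω → ℝ≥0) → ℝ≥0)
    (κ : Measure Ω) (f : Ω → ℝ≥0) : Prop :=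
  ∀ ε : ℝ≥0, 0 < ε → ∃ F : ℕ → Ω → ℝ≥0, (∀ n, Dominated μ U (F n)) ∧ Monotone F ∧
    (∀ ω, Tendsto (fun n => F n ω) atTop (𝓝 (f ω))) ∧
    ∀ n, (ψ (F n) : ℝ≥0∞) ≤ ∫⁻ ω, f ω ∂κ + ε

theorem ApproxBelow.add (hψ : IsPositiveOn μ U ψ) {κ : Measure Ω} {f g : Ω → ℝ≥0}
    (mf : Measurable f) (hf : ApproxBelow μ U ψ κ f) (hg : ApproxBelow μ U ψ κ g) :
    ApproxBelow μ U ψ κ (f + g) := by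
  intro ε hε
  obtain ⟨F, hF1, hF2, hF3, hF4⟩ := hf (ε / 2) (half_pos hε)
  obtain ⟨G, hG1, hG2, hG3, hG4⟩ := hg (ε / 2) (half_pos hε)
  refine ⟨F + G, fun n => (hF1 n).add (hG1 n), hF2.add hG2,
    fun ω => (hF3 ω).add (hG3 ω), fun n => ?_⟩
  have e : ∫⁻ ω, ((f + g) ω : ℝ≥0) ∂κ = ∫⁻ ω, f ω ∂κ + ∫⁻ ω, g ω ∂κ := by
    simp only [Pi.add_apply, ENNReal.coe_add]
    exact lintegral_add_left mf.coe_nnreal_ennreal _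
  rw [e, Pi.add_apply, hψ.add _ _ (hF1 n) (hG1 n), ENNReal.coe_add]
  refine (add_le_add (hF4 n) (hG4 n)).trans (le_of_eq ?_)
  rw [add_add_add_comm, ← ENNReal.coe_add, add_halves]

/-- Diagonal argument: approximate the j-th term with error δ j, where ∑ δ j < ε, and take as n-th
function the sum of the n-th approximants of the first n terms. -/
theorem ApproxBelow.of_tsum (hψ : IsPositiveOn μ U ψ) {κ : Measure Ω} {f : Ω → ℝ≥0}
    {s : ℕ → Ω → ℝ≥0} (ms : ∀ j, Measurable (s j)) (hs : ∀ j, ApproxBelow μ U ψ κ (s j))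
    (hf : ∀ ω, ∑' j, (s j ω : ℝ≥0∞) = f ω) : ApproxBelow μ U ψ κ f := by
  intro ε hε
  obtain ⟨δ, hδ, hδε⟩ := ENNReal.exists_pos_sum_of_countable
    (ENNReal.coe_ne_zero.2 hε.ne') ℕ
  choose F hF1 hF2 hF3 hF4 using fun j => hs j (δ j) (hδ j)
  have hle : ∀ j n ω, F j n ω ≤ s j ω := fun j n ω =>
    Monotone.ge_of_tendsto (fun a b hab => hF2 j hab ω) (hF3 j ω) n
  have hsum : ∀ n ω, ∑ j ∈ Finset.range n, s j ω ≤ f ω := by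
    intro n ω
    rw [← ENNReal.coe_le_coe, ← hf ω]
    push_cast
    exact ENNReal.sum_le_tsum _
  refine ⟨fun n => ∑ j ∈ Finset.range n, F j n, fun n => Dominated.sum _ fun j _ => hF1 j n,
    ?_, ?_, ?_⟩
  · intro n m hnm
    refine le_trans (Finset.sum_le_sum fun j _ => hF2 j hnm)
      (Finset.sum_le_sum_of_subset (Finset.range_mono hnm))
  · intro ω
    refine tendsto_order.2 ⟨fun a ha => ?_, fun a ha => Eventually.of_forall fun n => ?_⟩
    · have h1 : Tendsto (fun J => ∑ j ∈ Finset.range J, s j ω) atTop (𝓝 (f ω)) := by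
        rw [← ENNReal.tendsto_coe, ← hf ω]
        simpa using ENNReal.tendsto_nat_tsum fun j => (s j ω : ℝ≥0∞)
      obtain ⟨J, hJ⟩ := (h1.eventually_const_lt ha).exists
      have h2 : Tendsto (fun n => ∑ j ∈ Finset.range J, F j n ω) atTop
          (𝓝 (∑ j ∈ Finset.range J, s j ω)) := tendsto_finsetSum _ fun j _ => hF3 j ω
      filter_upwards [h2.eventually_const_lt hJ, eventually_ge_atTop J] with n hn hJn
      rw [Finset.sum_apply]
      exact hn.trans_le (Finset.sum_le_sum_of_subset (Finset.range_mono hJn))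
    · beta_reduce
      rw [Finset.sum_apply]
      exact ((Finset.sum_le_sum fun j _ => hle j n ω).trans (hsum n ω)).trans_lt ha
  · intro n
    rw [hψ.map_sum _ fun j _ => hF1 j n]
    push_cast
    calc ∑ j ∈ Finset.range n, (ψ (F j n) : ℝ≥0∞)
        ≤ ∑ j ∈ Finset.range n, (∫⁻ ω, s j ω ∂κ + δ j) := Finset.sum_le_sum fun j _ => hF4 j n
      _ = ∫⁻ ω, ∑ j ∈ Finset.range n, (s j ω : ℝ≥0∞) ∂κ + ∑ j ∈ Finset.range n, (δ j : ℝ≥0∞) := by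
          rw [Finset.sum_add_distrib, lintegral_finsetSum _ fun j _ => (ms j).coe_nnreal_ennreal]
      _ ≤ ∫⁻ ω, f ω ∂κ + ε := by
          refine add_le_add (lintegral_mono fun ω => ?_) ((ENNReal.sum_le_tsum _).trans hδε.le)
          simp only [← ENNReal.ofNNReal_finsetSum]
          exact ENNReal.coe_le_coe.2 (hsum n ω)

theorem lintegral_simpleFunc_le (hψ : IsPositiveOn μ U ψ) (f : SimpleFunc Ω ℝ≥0)
    (hf : Dominated μ U f) :
    ∫⁻ ω, f ω ∂(countablyAdditivePart hψ) ≤ ψ f := by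
  induction f using SimpleFunc.induction with
  | const c hs =>
    rename_i s
    have e : (SimpleFunc.piecewise s hs (SimpleFunc.const Ω c) (SimpleFunc.const Ω 0) : Ω → ℝ≥0)
        = c • s.indicator 1 := by
      ext ω
      by_cases h : ω ∈ s <;> simp [h]
    rw [e] at hf ⊢
    rcases eq_or_ne c 0 with rfl | hc
    · simp
    have hd : Dominated μ U (s.indicator 1) := by
      simpa [smul_smul, hc] using hf.smul c⁻¹
    rw [hψ.smul c _ hd]
    have e2 : ∀ ω, (((c • s.indicator (1 : Ω → ℝ≥0)) ω : ℝ≥0) : ℝ≥0∞)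
        = s.indicator (fun _ => (c : ℝ≥0∞)) ω := by
      intro ω
      by_cases h : ω ∈ s <;> simp [h]
    simp_rw [e2]
    rw [lintegral_indicator_const hs, ENNReal.coe_mul]
    gcongr
    exact countablyAdditivePart_le hψ hs hd
  | add _ ihf ihg =>
    rename_i f g _
    have hf' : Dominated μ U f := hf.mono f.measurable (ae_of_all _ fun ω => by simp)
    have hg' : Dominated μ U g := hf.mono g.measurable (ae_of_all _ fun ω => by simp)
    rw [SimpleFunc.coe_add, hψ.add _ _ hf' hg', ENNReal.coe_add]
    simp only [Pi.add_apply, ENNReal.coe_add]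
    rw [lintegral_add_left f.measurable.coe_nnreal_ennreal]
    exact add_le_add (ihf hf') (ihg hg')

theorem lintegral_countablyAdditivePart_le (hψ : IsPositiveOn μ U ψ) {f : Ω → ℝ≥0}
    (hf : Dominated μ U f) :
    ∫⁻ ω, f ω ∂(countablyAdditivePart hψ) ≤ ψ f := by
  rw [lintegral_eq_nnreal]
  refine iSup₂_le fun g hg => ?_
  have hg' : (g : Ω → ℝ≥0) ≤ f := fun ω => by exact_mod_cast hg ω
  have hd : Dominated μ U g := hf.mono g.measurable (ae_of_all _ hg')
  rw [← SimpleFunc.lintegral_eq_lintegral]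
  exact (lintegral_simpleFunc_le hψ g hd).trans
    (by exact_mod_cast hψ.mono _ _ hd hf (ae_of_all _ hg'))

theorem approxBelow_simpleFunc (hψ : IsPositiveOn μ U ψ) (f : SimpleFunc Ω ℝ≥0)
    (hf : Dominated μ U f) : ApproxBelow μ U ψ (countablyAdditivePart hψ) f := by
  induction f using SimpleFunc.induction with
  | const c hs =>
    rename_i s
    have e : (SimpleFunc.piecewise s hs (SimpleFunc.const Ω c) (SimpleFunc.const Ω 0) : Ω → ℝ≥0)
        = c • s.indicator 1 := by
      ext ω
      by_cases h : ω ∈ s <;> simp [h]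
    rw [e] at hf ⊢
    intro ε hε
    rcases eq_or_ne c 0 with rfl | hc
    · refine ⟨fun _ => 0, fun _ => Dominated.zero, monotone_const, fun ω => ?_, fun n => ?_⟩
      · simp
      · simp [hψ.map_zero]
    have hd : Dominated μ U (s.indicator 1) := by
      simpa [smul_smul, hc] using hf.smul c⁻¹
    obtain ⟨t, ht1, ht2, rfl, ht4⟩ := exists_cover_le hψ hs hd
      (δ := ((c⁻¹ * ε : ℝ≥0) : ℝ≥0∞)) (by simp [hc, hε.ne'])
    have htd : ∀ n, Dominated μ U ((t n).indicator 1) := fun n =>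
      hd.indicator_subset (ht1 n) (Set.subset_iUnion t n)
    refine ⟨fun n => c • (t n).indicator 1, fun n => (htd n).smul c, ?_, ?_, ?_⟩
    · intro n m hnm ω
      have := Set.indicator_le_indicator_of_subset (f := (1 : Ω → ℝ≥0)) (ht2 hnm)
        (fun _ => zero_le) ω
      exact mul_le_mul_right this c
    · intro ω
      exact (ht2.tendsto_indicator t (1 : Ω → ℝ≥0) ω |>.mono_right
        (pure_le_nhds _)).const_mul c
    · intro n
      rw [hψ.smul c _ (htd n)]
      have e2 : ∀ ω, (((c • (⋃ n, t n).indicator (1 : Ω → ℝ≥0)) ω : ℝ≥0) : ℝ≥0∞)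
          = (⋃ n, t n).indicator (fun _ => (c : ℝ≥0∞)) ω := by
        intro ω
        by_cases h : ω ∈ (⋃ n, t n) <;> simp [Set.indicator, h] at h ⊢
      simp_rw [e2]
      rw [lintegral_indicator_const hs, ENNReal.coe_mul]
      calc (c : ℝ≥0∞) * ψ ((t n).indicator 1)
          ≤ c * (countablyAdditivePart hψ (⋃ n, t n) + ((c⁻¹ * ε : ℝ≥0) : ℝ≥0∞)) := by
            gcongr
            exact ht4 n
        _ = _ := by
            rw [mul_add, ← ENNReal.coe_mul, mul_inv_cancel_left₀ hc]
  | add _ ihf ihg =>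
    rename_i f g _
    have hf' : Dominated μ U f := hf.mono f.measurable (ae_of_all _ fun ω => by simp)
    have hg' : Dominated μ U g := hf.mono g.measurable (ae_of_all _ fun ω => by simp)
    rw [SimpleFunc.coe_add]
    exact (ihf hf').add hψ f.measurable (ihg hg')

/-- A measurable f is a countable sum of simple functions, each dominated because it lies below f.
-/
theorem approxBelow_countablyAdditivePart (hψ : IsPositiveOn μ U ψ) {f : Ω → ℝ≥0}
    (hf : Dominated μ U f) : ApproxBelow μ U ψ (countablyAdditivePart hψ) f := by
  have hsum := SimpleFunc.tsum_eapproxDiff (fun ω => (f ω : ℝ≥0∞)) hf.1.coe_nnreal_ennreal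
  refine ApproxBelow.of_tsum hψ (fun j => SimpleFunc.measurable _) (fun j => ?_) hsum
  refine approxBelow_simpleFunc hψ _ (hf.mono (SimpleFunc.measurable _) (ae_of_all _ fun ω => ?_))
  have := (ENNReal.le_tsum j).trans_eq (hsum ω)
  exact_mod_cast this

/-- Representation of the countably additive part of `ψ` by a density. -/
theorem exists_density [SigmaFinite μ] (hψ : IsPositiveOn μ U ψ) :
    ∃ (B : ℕ → Set Ω) (v : Ω → ℝ≥0∞), Measurable v ∧ Monotone B ∧ (∀ n, MeasurableSet (B n)) ∧
      (∀ n, Dominated μ U ((B n).indicator 1)) ∧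
      (∀ f, Dominated μ U f → ∀ᵐ ω ∂μ, ω ∉ ⋃ n, B n → f ω = 0) ∧
      (∀ᵐ ω ∂μ, v ω < ∞) ∧
      (∀ f, Dominated μ U f → ∫⁻ ω, f ω * v ω ∂μ ≤ ψ f) ∧
      ∀ f, Dominated μ U f → ∀ ε : ℝ≥0, 0 < ε →
        ∃ F : ℕ → Ω → ℝ≥0, (∀ n, Dominated μ U (F n)) ∧ Monotone F ∧
          (∀ ω, Tendsto (fun n => F n ω) atTop (𝓝 (f ω))) ∧
          ∀ n, (ψ (F n) : ℝ≥0∞) ≤ ∫⁻ ω, f ω * v ω ∂μ + ε := by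
  obtain ⟨B, hB1, hB2, hB3, hB4⟩ := exists_exhausting_sets (μ := μ) U
  have hBm : MeasurableSet (⋃ n, B n) := MeasurableSet.iUnion hB2
  set lam := countablyAdditivePart hψ with hlam
  -- Only after restriction to the support of the cone is σ-finiteness certain: ψ is finite on each
  -- B n, and the complement of the support becomes null. Nothing is lost, as dominated functions
  -- vanish a.e. there.
  have : SigmaFinite (lam.restrict (⋃ n, B n)) := by
    refine ⟨⟨⟨fun n => B n ∪ (⋃ n, B n)ᶜ, fun _ => trivial, fun n => ?_, ?_⟩⟩⟩
    · rw [Measure.restrict_apply ((hB2 n).union hBm.compl)]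
      have : (B n ∪ (⋃ n, B n)ᶜ) ∩ (⋃ n, B n) = B n := by
        rw [Set.union_inter_distrib_right, Set.compl_inter_self, Set.union_empty]
        exact Set.inter_eq_left.2 (Set.subset_iUnion B n)
      rw [this]
      exact (countablyAdditivePart_le hψ (hB2 n) (hB3 n)).trans_lt ENNReal.coe_lt_top
    · rw [← Set.iUnion_union, Set.union_compl_self]
  have hac : lam.restrict (⋃ n, B n) ≪ μ :=
    Measure.absolutelyContinuous_restrict.trans (countablyAdditivePart_absolutelyContinuous hψ)
  have hd := Measure.withDensity_rnDeriv_eq _ _ hac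
  set v := (lam.restrict (⋃ n, B n)).rnDeriv μ with hv
  have hvm : Measurable v := Measure.measurable_rnDeriv _ _
  have hint : ∀ f, Dominated μ U f → ∫⁻ ω, f ω * v ω ∂μ = ∫⁻ ω, f ω ∂lam := by
    intro f hf
    have h1 : ∫⁻ ω, f ω * v ω ∂μ = ∫⁻ ω, f ω ∂(μ.withDensity v) := by
      rw [lintegral_withDensity_eq_lintegral_mul _ hvm hf.1.coe_nnreal_ennreal]
      simp [mul_comm]
    rw [h1, hd, ← lintegral_indicator hBm]
    refine lintegral_congr_ae ?_
    filter_upwards [(countablyAdditivePart_absolutelyContinuous hψ).ae_le (hB4 f hf)] with ω hω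
    by_cases h : ω ∈ ⋃ n, B n
    · rw [Set.indicator_of_mem h]
    · rw [Set.indicator_of_notMem h, hω h, ENNReal.coe_zero]
  refine ⟨B, v, hvm, hB1, hB2, hB3, hB4, Measure.rnDeriv_lt_top _ _, ?_, ?_⟩
  · intro f hf
    rw [hint f hf]
    exact lintegral_countablyAdditivePart_le hψ hf
  · intro f hf
    rw [hint f hf]
    exact approxBelow_countablyAdditivePart hψ hf

end representation

/-! ### The quasi norm on functions and the functional f ↦ ‖f^{1/r}‖^r -/

namespace QuasiKotheSpace

section eNorm

variable {Ω : Type*} [MeasurableSpace Ω] {μ : Measure Ω} (X : QuasiKotheSpace μ)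

theorem mem_iff_exists {f : Ω → ℝ} : X.Mem f ↔ ∃ x : X.carrier, f =ᵐ[μ] (x : Ω →ₘ[μ] ℝ) := by
  constructor
  · rintro ⟨h, hm⟩
    exact ⟨⟨_, hm⟩, (AEEqFun.coeFn_mk f h).symm⟩
  · rintro ⟨x, hx⟩
    have h : AEStronglyMeasurable f μ := (x : Ω →ₘ[μ] ℝ).aestronglyMeasurable.congr hx.symm
    refine ⟨h, ?_⟩
    have : AEEqFun.mk f h = (x : Ω →ₘ[μ] ℝ) :=
      AEEqFun.ext ((AEEqFun.coeFn_mk f h).trans hx)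
    rw [this]
    exact x.2

theorem eNorm_eq_of_ae_eq {f : Ω → ℝ} (x : X.carrier) (hx : f =ᵐ[μ] (x : Ω →ₘ[μ] ℝ)) :
    X.eNorm f = ENNReal.ofReal (X.qnorm x) := by
  have h : X.Mem f := X.mem_iff_exists.2 ⟨x, hx⟩
  rw [eNorm, dif_pos h]
  congr 2
  exact Subtype.ext (AEEqFun.ext ((AEEqFun.coeFn_mk f h.fst).trans hx))

theorem eNorm_ne_top_iff {f : Ω → ℝ} : X.eNorm f ≠ ∞ ↔ X.Mem f := by
  by_cases h : X.Mem f <;> simp [eNorm, h]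

theorem eNorm_congr {f g : Ω → ℝ} (h : f =ᵐ[μ] g) : X.eNorm f = X.eNorm g := by
  by_cases hg : X.Mem g
  · obtain ⟨x, hx⟩ := X.mem_iff_exists.1 hg
    rw [X.eNorm_eq_of_ae_eq x hx, X.eNorm_eq_of_ae_eq x (h.trans hx)]
  · have hf : ¬ X.Mem f := fun hf => by
      obtain ⟨x, hx⟩ := X.mem_iff_exists.1 hf
      exact hg (X.mem_iff_exists.2 ⟨x, h.symm.trans hx⟩)
    rw [eNorm, dif_neg hf, eNorm, dif_neg hg]

theorem eNorm_mono {f g : Ω → ℝ} (hf : AEStronglyMeasurable f μ)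
    (h : ∀ᵐ ω ∂μ, |f ω| ≤ |g ω|) : X.eNorm f ≤ X.eNorm g := by
  by_cases hg : X.Mem g
  · obtain ⟨y, hy⟩ := X.mem_iff_exists.1 hg
    obtain ⟨hx, hn⟩ := X.solid (AEEqFun.mk f hf) y (by
      filter_upwards [h, hy, AEEqFun.coeFn_mk f hf] with ω h1 h2 h3
      rwa [h3, ← h2])
    rw [X.eNorm_eq_of_ae_eq y hy, X.eNorm_eq_of_ae_eq ⟨_, hx⟩ (AEEqFun.coeFn_mk f hf).symm]
    exact ENNReal.ofReal_le_ofReal hn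
  · rw [not_iff_not.2 X.eNorm_ne_top_iff |>.2 hg |> not_ne_iff.1]
    exact le_top

theorem eNorm_const_mul {f : Ω → ℝ} (hf : X.Mem f) (c : ℝ) :
    X.eNorm (fun ω => c * f ω) = ENNReal.ofReal |c| * X.eNorm f := by
  obtain ⟨x, hx⟩ := X.mem_iff_exists.1 hf
  rw [X.eNorm_eq_of_ae_eq x hx, X.eNorm_eq_of_ae_eq (c • x), X.qnorm_smul,
    ENNReal.ofReal_mul (abs_nonneg c)]
  filter_upwards [hx, AEEqFun.coeFn_smul c (x : Ω →ₘ[μ] ℝ)] with ω h1 h2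
  rw [h1, Submodule.coe_smul, h2, Pi.smul_apply, smul_eq_mul]

theorem mem_add {f g : Ω → ℝ} (hf : X.Mem f) (hg : X.Mem g) : X.Mem (fun ω => f ω + g ω) := by
  obtain ⟨x, hx⟩ := X.mem_iff_exists.1 hf
  obtain ⟨y, hy⟩ := X.mem_iff_exists.1 hg
  refine X.mem_iff_exists.2 ⟨x + y, ?_⟩
  filter_upwards [hx, hy, AEEqFun.coeFn_add (x : Ω →ₘ[μ] ℝ) y] with ω h1 h2 h3
  rw [h1, h2, Submodule.coe_add, h3, Pi.add_apply]

theorem mem_const_mul {f : Ω → ℝ} (hf : X.Mem f) (c : ℝ) : X.Mem (fun ω => c * f ω) := by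
  rw [← eNorm_ne_top_iff, X.eNorm_const_mul hf]
  exact ENNReal.mul_ne_top ENNReal.ofReal_ne_top (X.eNorm_ne_top_iff.2 hf)

theorem mem_of_le {f g : Ω → ℝ} (hf : AEStronglyMeasurable f μ)
    (h : ∀ᵐ ω ∂μ, |f ω| ≤ |g ω|) (hg : X.Mem g) : X.Mem f := by
  rw [← eNorm_ne_top_iff] at hg ⊢
  exact ne_top_of_le_ne_top hg (X.eNorm_mono hf h)

end eNorm

section powNorm

variable {Ω : Type*} [MeasurableSpace Ω] {μ : Measure Ω} (X : QuasiKotheSpace μ) {r : ℝ}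

/-- The functional `f ↦ ‖f^{1/r}‖^r` on nonnegative functions. -/
noncomputable def powNorm (r : ℝ) (f : Ω → ℝ≥0) : ℝ≥0∞ :=
  X.eNorm (fun ω => (f ω : ℝ) ^ (1 / r)) ^ r

theorem powNorm_ne_top_iff (hr : 0 < r) {f : Ω → ℝ≥0} :
    X.powNorm r f ≠ ∞ ↔ X.Mem (fun ω => (f ω : ℝ) ^ (1 / r)) := by
  rw [powNorm, ← eNorm_ne_top_iff, Ne, ENNReal.rpow_eq_top_iff_of_pos hr]

theorem measurable_rpow_coe {f : Ω → ℝ≥0} (hf : Measurable f) (s : ℝ) :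
    Measurable (fun ω => (f ω : ℝ) ^ s) :=
  hf.coe_nnreal_real.pow_const s

theorem powNorm_mono (hr : 0 < r) {f g : Ω → ℝ≥0} (hf : Measurable f) (h : f ≤ᵐ[μ] g) :
    X.powNorm r f ≤ X.powNorm r g := by
  refine ENNReal.rpow_le_rpow (X.eNorm_mono (measurable_rpow_coe hf _).aestronglyMeasurable ?_)
    hr.le
  filter_upwards [h] with ω hω
  rw [abs_of_nonneg (by positivity), abs_of_nonneg (by positivity)]
  exact Real.rpow_le_rpow (by positivity) (by exact_mod_cast hω) (by positivity)

theorem powNorm_smul (hr : 0 < r) {f : Ω → ℝ≥0} (hf : X.powNorm r f ≠ ∞) (c : ℝ≥0) :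
    X.powNorm r (c • f) = c * X.powNorm r f := by
  have e : (fun ω => (((c • f) ω : ℝ≥0) : ℝ) ^ (1 / r))
      = fun ω => (c : ℝ) ^ (1 / r) * (f ω : ℝ) ^ (1 / r) := by
    ext ω
    rw [Pi.smul_apply, smul_eq_mul, NNReal.coe_mul, Real.mul_rpow (by positivity) (by positivity)]
  rw [powNorm, e, X.eNorm_const_mul ((X.powNorm_ne_top_iff hr).1 hf),
    ENNReal.mul_rpow_of_nonneg _ _ hr.le, powNorm, abs_of_nonneg (by positivity),
    ENNReal.ofReal_rpow_of_nonneg (by positivity) hr.le, ← Real.rpow_mul (by positivity),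
    one_div_mul_cancel hr.ne', Real.rpow_one, ENNReal.ofReal_coe_nnreal]

theorem exists_ae_eq_of_powNorm_ne_top (hr : 0 < r) {f : Ω → ℝ≥0} (hf : X.powNorm r f ≠ ∞) :
    ∃ x : X.carrier, (fun ω => (f ω : ℝ) ^ (1 / r)) =ᵐ[μ] (x : Ω →ₘ[μ] ℝ) :=
  X.mem_iff_exists.1 ((X.powNorm_ne_top_iff hr).1 hf)

theorem powNorm_eq_of_ae_eq {f : Ω → ℝ≥0} (x : X.carrier)
    (hx : (fun ω => (f ω : ℝ) ^ (1 / r)) =ᵐ[μ] (x : Ω →ₘ[μ] ℝ)) :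
    X.powNorm r f = ENNReal.ofReal (X.qnorm x) ^ r := by
  rw [powNorm, X.eNorm_eq_of_ae_eq x hx]

theorem ae_eq_zero_of_powNorm_eq_zero (hr : 0 < r) {f : Ω → ℝ≥0} (hf : X.powNorm r f = 0) :
    f =ᵐ[μ] 0 := by
  obtain ⟨x, hx⟩ := X.exists_ae_eq_of_powNorm_ne_top hr (f := f) (by simp [hf])
  rw [X.powNorm_eq_of_ae_eq x hx, ENNReal.rpow_eq_zero_iff_of_pos hr, ENNReal.ofReal_eq_zero] at hf
  have h0 : x = 0 := (X.qnorm_eq_zero_iff x).1 (le_antisymm hf (X.qnorm_nonneg x))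
  subst h0
  filter_upwards [hx, AEEqFun.coeFn_zero (α := Ω) (β := ℝ) (μ := μ)] with ω h1 h2
  rw [Submodule.coe_zero, h2, Pi.zero_apply, Real.rpow_eq_zero (by positivity) (by positivity)]
    at h1
  exact_mod_cast h1

theorem rpow_add_le_two_rpow_mul {a b s : ℝ} (ha : 0 ≤ a) (hb : 0 ≤ b) (hs : 0 ≤ s) :
    (a + b) ^ s ≤ 2 ^ s * (a ^ s + b ^ s) := by
  have h1 : 0 ≤ a ^ s := by positivity
  have h2 : 0 ≤ b ^ s := by positivity
  rcases le_total a b with h | h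
  · calc (a + b) ^ s ≤ (2 * b) ^ s := Real.rpow_le_rpow (by positivity) (by linarith) hs
      _ = 2 ^ s * b ^ s := Real.mul_rpow (by norm_num) hb
      _ ≤ _ := by gcongr; linarith
  · calc (a + b) ^ s ≤ (2 * a) ^ s := Real.rpow_le_rpow (by positivity) (by linarith) hs
      _ = 2 ^ s * a ^ s := Real.mul_rpow (by norm_num) ha
      _ ≤ _ := by gcongr; linarith

theorem powNorm_add_ne_top (hr : 0 < r) {f g : Ω → ℝ≥0} (hfm : Measurable f) (hgm : Measurable g)
    (hf : X.powNorm r f ≠ ∞) (hg : X.powNorm r g ≠ ∞) : X.powNorm r (f + g) ≠ ∞ := by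
  rw [X.powNorm_ne_top_iff hr] at hf hg ⊢
  refine X.mem_of_le (measurable_rpow_coe (hfm.add hgm) _).aestronglyMeasurable
    (ae_of_all _ fun ω => ?_) (X.mem_const_mul (X.mem_add hf hg) (2 ^ (1 / r)))
  rw [abs_of_nonneg (by positivity), abs_of_nonneg (by positivity), Pi.add_apply, NNReal.coe_add]
  exact rpow_add_le_two_rpow_mul (by positivity) (by positivity) (by positivity)

theorem powNorm_zero (hr : 0 < r) : X.powNorm r (0 : Ω → ℝ≥0) = 0 := by
  rw [X.powNorm_eq_of_ae_eq 0]
  · simp [(X.qnorm_eq_zero_iff 0).2 rfl, ENNReal.zero_rpow_of_pos hr]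
  · filter_upwards [AEEqFun.coeFn_zero (α := Ω) (β := ℝ) (μ := μ)] with ω h2
    rw [Submodule.coe_zero, h2]
    simp [Real.zero_rpow (inv_pos.2 hr).ne']

theorem powNorm_sum_ne_top (hr : 0 < r) {ι : Type*} (s : Finset ι) {f : ι → Ω → ℝ≥0}
    (hfm : ∀ i, Measurable (f i)) (hf : ∀ i, X.powNorm r (f i) ≠ ∞) :
    X.powNorm r (∑ i ∈ s, f i) ≠ ∞ := by
  classical
  induction s using Finset.induction_on with
  | empty => simp [X.powNorm_zero hr]
  | insert a s ha ih =>
    rw [Finset.sum_insert ha]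
    refine X.powNorm_add_ne_top hr (hfm a) ?_ (hf a) ih
    convert Finset.measurable_sum s (fun i _ => hfm i) using 1
    ext ω
    rw [Finset.sum_apply]

theorem rpow_sum_ae_eq (hr : 0 < r) {n : ℕ} {f : Fin n → Ω → ℝ≥0} {x : Fin n → X.carrier}
    (hx : ∀ k, (fun ω => (f k ω : ℝ) ^ (1 / r)) =ᵐ[μ] (x k : Ω →ₘ[μ] ℝ)) :
    (fun ω => (∑ k, |(x k : Ω →ₘ[μ] ℝ) ω| ^ r) ^ (1 / r)) =ᵐ[μ]
      fun ω => (((∑ k, f k) ω : ℝ≥0) : ℝ) ^ (1 / r) := by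
  filter_upwards [ae_all_iff.2 hx] with ω h
  rw [Finset.sum_apply, NNReal.coe_sum]
  congr 2 with k
  rw [← h k, abs_of_nonneg (by positivity), ← Real.rpow_mul (by positivity),
    one_div_mul_cancel hr.ne', Real.rpow_one]

theorem powNorm_sum_le {c : ℝ≥0} (hr : 0 < r) (hc : X.ConvexWith r c) {n : ℕ}
    {f : Fin n → Ω → ℝ≥0} (hf : ∀ k, X.powNorm r (f k) ≠ ∞) :
    X.powNorm r (∑ k, f k) ≤ (c : ℝ≥0∞) ^ r * ∑ k, X.powNorm r (f k) := by
  choose x hx using fun k => X.exists_ae_eq_of_powNorm_ne_top hr (hf k)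
  have h := ENNReal.rpow_le_rpow (hc n x) hr.le
  rw [X.eNorm_congr (X.rpow_sum_ae_eq hr hx), ENNReal.mul_rpow_of_nonneg _ _ hr.le,
    ← ENNReal.rpow_mul, one_div_mul_cancel hr.ne', ENNReal.rpow_one] at h
  refine h.trans_eq ?_
  congr 1
  exact Finset.sum_congr rfl fun k _ => (X.powNorm_eq_of_ae_eq (x k) (hx k)).symm

theorem sum_powNorm_le {c : ℝ≥0} (hr : 0 < r) (hc : X.ConcaveWith r c) {n : ℕ}
    {f : Fin n → Ω → ℝ≥0} (hf : ∀ k, X.powNorm r (f k) ≠ ∞) :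
    ∑ k, X.powNorm r (f k) ≤ (c : ℝ≥0∞) ^ r * X.powNorm r (∑ k, f k) := by
  choose x hx using fun k => X.exists_ae_eq_of_powNorm_ne_top hr (hf k)
  have h := ENNReal.rpow_le_rpow (hc n x) hr.le
  rw [X.eNorm_congr (X.rpow_sum_ae_eq hr hx), ENNReal.mul_rpow_of_nonneg _ _ hr.le,
    ← ENNReal.rpow_mul, one_div_mul_cancel hr.ne', ENNReal.rpow_one] at h
  refine le_trans (le_of_eq ?_) h
  exact Finset.sum_congr rfl fun k _ => X.powNorm_eq_of_ae_eq (x k) (hx k)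

/-- Finiteness is needed to divide by this quantity when showing that the best concavity constant is
attained. -/
theorem eNorm_rpow_sum_ne_top (hr : 0 < r) {n : ℕ} (x : Fin n → X.carrier) :
    X.eNorm (fun ω => (∑ k, |(x k : Ω →ₘ[μ] ℝ) ω| ^ r) ^ (1 / r)) ≠ ∞ := by
  let f : Fin n → Ω → ℝ≥0 := fun k ω => (|(x k : Ω →ₘ[μ] ℝ) ω| ^ r).toNNReal
  have hm : ∀ k, Measurable (f k) := fun k =>
    ((x k : Ω →ₘ[μ] ℝ).measurable.abs.pow_const r).real_toNNReal
  have hf : ∀ k ω, ((f k ω : ℝ≥0) : ℝ) = |(x k : Ω →ₘ[μ] ℝ) ω| ^ r := fun k ω =>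
    Real.coe_toNNReal _ (by positivity)
  have hfin : ∀ k, X.powNorm r (f k) ≠ ∞ := fun k => by
    rw [X.powNorm_ne_top_iff hr]
    refine X.mem_of_le (measurable_rpow_coe (hm k) _).aestronglyMeasurable
      (ae_of_all _ fun ω => le_of_eq ?_) (X.mem_iff_exists.2 ⟨x k, ae_eq_rfl⟩)
    rw [hf, ← Real.rpow_mul (by positivity), mul_one_div_cancel hr.ne', Real.rpow_one, abs_abs]
  have h := X.powNorm_sum_ne_top hr Finset.univ hm hfin
  rw [X.powNorm_ne_top_iff hr, ← eNorm_ne_top_iff] at h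
  convert h using 3 with ω
  rw [Finset.sum_apply, NNReal.coe_sum]
  simp only [hf]

/-- The infimum is attained: for a fixed family the inequality is a lower bound on c after division
by S, and it passes to the infimum. If S = 0, any admissible constant already forces the left side
to vanish. -/
theorem exists_convexWith_best (hr : 0 < r) (hX : X.IsRConvex r) :
    ∃ c : ℝ≥0, X.ConvexWith r c ∧ (c : ℝ≥0∞) = X.convexityConst r := by
  obtain ⟨c₀, hc₀⟩ := hX
  have hfin : X.convexityConst r ≠ ∞ :=
    ne_top_of_le_ne_top ENNReal.coe_ne_top (iInf₂_le c₀ hc₀)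
  refine ⟨(X.convexityConst r).toNNReal, fun n x => ?_, ENNReal.coe_toNNReal hfin⟩
  rw [ENNReal.coe_toNNReal hfin]
  set S := (∑ k, ENNReal.ofReal (X.qnorm (x k)) ^ r) ^ (1 / r)
  by_cases hS : S = 0
  · have := hc₀ n x
    change _ ≤ c₀ * S at this
    rw [hS, mul_zero] at this ⊢
    exact this
  have hS' : S ≠ ∞ := ENNReal.rpow_ne_top_of_nonneg (by positivity)
    (ENNReal.sum_ne_top.2 fun k _ => ENNReal.rpow_ne_top_of_nonneg hr.le ENNReal.ofReal_ne_top)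
  rw [← ENNReal.div_le_iff_le_mul (Or.inl hS) (Or.inl hS')]
  exact le_iInf₂ fun c hc => (ENNReal.div_le_iff_le_mul (Or.inl hS) (Or.inl hS')).2 (hc n x)

theorem exists_concaveWith_best (hr : 0 < r) (hX : X.IsRConcave r) :
    ∃ c : ℝ≥0, X.ConcaveWith r c ∧ (c : ℝ≥0∞) = X.concavityConst r := by
  obtain ⟨c₀, hc₀⟩ := hX
  have hfin : X.concavityConst r ≠ ∞ :=
    ne_top_of_le_ne_top ENNReal.coe_ne_top (iInf₂_le c₀ hc₀)
  refine ⟨(X.concavityConst r).toNNReal, fun n x => ?_, ENNReal.coe_toNNReal hfin⟩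
  rw [ENNReal.coe_toNNReal hfin]
  have hS' := X.eNorm_rpow_sum_ne_top hr x
  set S := X.eNorm (fun ω => (∑ k, |(x k : Ω →ₘ[μ] ℝ) ω| ^ r) ^ (1 / r))
  by_cases hS : S = 0
  · have := hc₀ n x
    change _ ≤ c₀ * S at this
    rw [hS, mul_zero] at this ⊢
    exact this
  rw [← ENNReal.div_le_iff_le_mul (Or.inl hS) (Or.inl hS')]
  exact le_iInf₂ fun c hc => (ENNReal.div_le_iff_le_mul (Or.inl hS) (Or.inl hS')).2 (hc n x)

theorem tendsto_powNorm_of_monotone (hr : 0 < r) {F : ℕ → Ω → ℝ≥0} {f : Ω → ℝ≥0}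
    (hF : ∀ n, X.powNorm r (F n) ≠ ∞) (hf : X.powNorm r f ≠ ∞) (hmono : Monotone F)
    (hlim : ∀ ω, Tendsto (fun n => F n ω) atTop (𝓝 (f ω))) :
    Tendsto (fun n => X.powNorm r (F n)) atTop (𝓝 (X.powNorm r f)) := by
  choose x hx using fun k => X.exists_ae_eq_of_powNorm_ne_top hr (hF k)
  obtain ⟨y, hy⟩ := X.exists_ae_eq_of_powNorm_ne_top hr hf
  have h := X.fatou x y (by
    filter_upwards [ae_all_iff.2 hx, hy] with ω h1 h2
    simp only [← h1, ← h2]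
    refine ⟨fun n => by positivity, fun n m hnm => ?_, ?_⟩
    · exact Real.rpow_le_rpow (by positivity) (by exact_mod_cast hmono hnm ω) (by positivity)
    · exact ((NNReal.tendsto_coe.2 (hlim ω)).rpow_const (Or.inr (by positivity))))
  simp_rw [fun k => X.powNorm_eq_of_ae_eq (x k) (hx k), X.powNorm_eq_of_ae_eq y hy]
  exact (ENNReal.continuous_rpow_const.tendsto _).comp (ENNReal.tendsto_ofReal h)

theorem tendsto_powNorm_zero (hr : 0 < r) (hX : X.IsSigmaOrderContinuous) {F : ℕ → Ω → ℝ≥0}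
    (hF : ∀ n, X.powNorm r (F n) ≠ ∞) (hanti : Antitone F)
    (hlim : ∀ ω, Tendsto (fun n => F n ω) atTop (𝓝 0)) :
    Tendsto (fun n => X.powNorm r (F n)) atTop (𝓝 0) := by
  choose x hx using fun k => X.exists_ae_eq_of_powNorm_ne_top hr (hF k)
  have h := hX x (by
    filter_upwards [ae_all_iff.2 hx] with ω h1
    simp only [← h1]
    refine ⟨fun n => by positivity, fun n m hnm => ?_, ?_⟩
    · exact Real.rpow_le_rpow (by positivity) (by exact_mod_cast hanti hnm ω) (by positivity)
    · have := (NNReal.tendsto_coe.2 (hlim ω)).rpow_const (p := 1 / r) (Or.inr (by positivity))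
      simpa [Real.zero_rpow (inv_pos.2 hr).ne'] using this)
  simp_rw [fun k => X.powNorm_eq_of_ae_eq (x k) (hx k)]
  have h2 := (ENNReal.continuous_rpow_const (y := r)).tendsto _ |>.comp (ENNReal.tendsto_ofReal h)
  simpa [Function.comp_def, ENNReal.zero_rpow_of_pos hr] using h2

end powNorm

end QuasiKotheSpace

/-! ### Order bounded series and a weak Fatou property from completeness -/

namespace QuasiKotheSpace

variable {Ω : Type*} [MeasurableSpace Ω] {μ : Measure Ω}

theorem qnorm_zero (X : QuasiKotheSpace μ) : X.qnorm 0 = 0 := (X.qnorm_eq_zero_iff 0).2 rfl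

theorem qnorm_neg (X : QuasiKotheSpace μ) (x : X.carrier) : X.qnorm (-x) = X.qnorm x := by
  have e : -x = (-1 : ℝ) • x := (neg_one_smul ℝ x).symm
  rw [e, X.qnorm_smul, abs_neg, abs_one, one_mul]

theorem exists_one_le_qnorm_add_le (X : QuasiKotheSpace μ) :
    ∃ K : ℝ, 1 ≤ K ∧ ∀ x y, X.qnorm (x + y) ≤ K * (X.qnorm x + X.qnorm y) := by
  obtain ⟨K, hK⟩ := X.exists_qnorm_add_le
  refine ⟨max K 1, le_max_right _ _, fun x y => (hK x y).trans ?_⟩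
  have := add_nonneg (X.qnorm_nonneg x) (X.qnorm_nonneg y)
  gcongr
  exact le_max_left _ _

/-- The decay rate (2K)⁻¹ beats the quasi triangle constant: splitting off the first term costs a
factor K, and K(q^n + q^n) = 2K q^n for q = (2K)⁻¹, so the bound reproduces itself. -/
theorem qnorm_sum_range_le (X : QuasiKotheSpace μ) {K : ℝ} (hK1 : 1 ≤ K)
    (hK : ∀ x y, X.qnorm (x + y) ≤ K * (X.qnorm x + X.qnorm y)) {u : ℕ → X.carrier}
    (hu : ∀ k, X.qnorm (u k) ≤ (2 * K)⁻¹ ^ k) (j n : ℕ) :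
    X.qnorm (∑ k ∈ Finset.range j, u (n + k)) ≤ 2 * K * (2 * K)⁻¹ ^ n := by
  induction j generalizing n with
  | zero =>
    rw [Finset.sum_range_zero, qnorm_zero]
    positivity
  | succ j ih =>
    rw [Finset.sum_range_succ', add_comm]
    refine (hK _ _).trans ?_
    have h1 := hu n
    have h2 := ih (n + 1)
    have e : ∑ k ∈ Finset.range j, u (n + (k + 1)) = ∑ k ∈ Finset.range j, u (n + 1 + k) :=
      Finset.sum_congr rfl fun k _ => congrArg u (by omega)
    rw [e, add_zero]
    have h3 : 2 * K * (2 * K)⁻¹ ^ (n + 1) = (2 * K)⁻¹ ^ n := by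
      rw [pow_succ]
      field_simp
    rw [h3] at h2
    calc _ ≤ K * ((2 * K)⁻¹ ^ n + (2 * K)⁻¹ ^ n) := by gcongr
      _ = _ := by ring

/-- The limit of an increasing sequence dominates its members. -/
theorem le_of_tendsto_qnorm (X : QuasiKotheSpace μ) {u : ℕ → X.carrier} {S : X.carrier}
    (hmono : ∀ n m, n ≤ m →
      ∀ᵐ ω ∂μ, (u n : Ω →ₘ[μ] ℝ) ω ≤ (u m : Ω →ₘ[μ] ℝ) ω)
    (h : Tendsto (fun n => X.qnorm (u n - S)) atTop (𝓝 0)) (n : ℕ) :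
    ∀ᵐ ω ∂μ, (u n : Ω →ₘ[μ] ℝ) ω ≤ (S : Ω →ₘ[μ] ℝ) ω := by
  -- The positive part of u n - S is at most |u m - S| for every m ≥ n, hence has quasi norm 0.
  let d : Ω → ℝ := fun ω => max ((u n : Ω →ₘ[μ] ℝ) ω - (S : Ω →ₘ[μ] ℝ) ω) 0
  have hd : AEStronglyMeasurable d μ :=
    (((u n : Ω →ₘ[μ] ℝ).measurable.sub (S : Ω →ₘ[μ] ℝ).measurable).max
      measurable_const).aestronglyMeasurable
  have key : ∀ m, n ≤ m → X.eNorm d ≤ ENNReal.ofReal (X.qnorm (u m - S)) := by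
    intro m hm
    rw [← X.eNorm_eq_of_ae_eq (u m - S) ae_eq_rfl]
    refine X.eNorm_mono hd ?_
    filter_upwards [hmono n m hm, AEEqFun.coeFn_sub (u m : Ω →ₘ[μ] ℝ) S] with ω h1 h2
    rw [Submodule.coe_sub, h2, Pi.sub_apply, abs_of_nonneg (le_max_right _ _)]
    exact max_le ((sub_le_sub_right h1 _).trans (le_abs_self _)) (abs_nonneg _)
  have h0 : X.eNorm d ≤ 0 := by
    have := ENNReal.tendsto_ofReal h
    rw [ENNReal.ofReal_zero] at this
    exact ge_of_tendsto this ((eventually_ge_atTop n).mono key)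
  obtain ⟨x, hx⟩ := X.mem_iff_exists.1 (X.eNorm_ne_top_iff.1 (ne_top_of_le_ne_top (by simp) h0))
  rw [X.eNorm_eq_of_ae_eq x hx, nonpos_iff_eq_zero, ENNReal.ofReal_eq_zero] at h0
  obtain rfl : x = 0 := (X.qnorm_eq_zero_iff x).1 (le_antisymm h0 (X.qnorm_nonneg x))
  filter_upwards [hx, AEEqFun.coeFn_zero (α := Ω) (β := ℝ) (μ := μ)] with ω h1 h2
  rw [Submodule.coe_zero, h2, Pi.zero_apply] at h1
  have : (u n : Ω →ₘ[μ] ℝ) ω - (S : Ω →ₘ[μ] ℝ) ω ≤ d ω := le_max_left _ _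
  linarith

theorem coeFn_sum_range (X : QuasiKotheSpace μ) (u : ℕ → X.carrier) (n : ℕ) :
    ((∑ k ∈ Finset.range n, u k : X.carrier) : Ω →ₘ[μ] ℝ) =ᵐ[μ]
      fun ω => ∑ k ∈ Finset.range n, (u k : Ω →ₘ[μ] ℝ) ω := by
  induction n with
  | zero =>
    filter_upwards [AEEqFun.coeFn_zero (α := Ω) (β := ℝ) (μ := μ)] with ω h
    rw [Finset.sum_range_zero, Finset.sum_range_zero, Submodule.coe_zero, h, Pi.zero_apply]
  | succ n ih =>
    rw [Finset.sum_range_succ]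
    filter_upwards [ih, AEEqFun.coeFn_add
      ((∑ k ∈ Finset.range n, u k : X.carrier) : Ω →ₘ[μ] ℝ) (u n)] with ω h1 h2
    rw [Submodule.coe_add, h2, Pi.add_apply, h1, Finset.sum_range_succ]

end QuasiKotheSpace

namespace QuasiBanachFunctionSpace

variable {Ω : Type*} [MeasurableSpace Ω] {μ : Measure Ω} (X : QuasiBanachFunctionSpace μ)

/-- The partial sums of a rapidly converging series of nonnegative functions are order bounded. -/
theorem exists_sum_range_le {K : ℝ} (hK1 : 1 ≤ K)
    (hK : ∀ x y, X.qnorm (x + y) ≤ K * (X.qnorm x + X.qnorm y)) {u : ℕ → X.carrier}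
    (hu : ∀ k, X.qnorm (u k) ≤ (2 * K)⁻¹ ^ k)
    (hpos : ∀ k, ∀ᵐ ω ∂μ, 0 ≤ (u k : Ω →ₘ[μ] ℝ) ω) :
    ∃ S : X.carrier, ∀ᵐ ω ∂μ, ∀ n,
      ∑ k ∈ Finset.range n, (u k : Ω →ₘ[μ] ℝ) ω ≤ (S : Ω →ₘ[μ] ℝ) ω := by
  have htail : ∀ n m, n ≤ m → X.qnorm (∑ k ∈ Finset.range m, u k - ∑ k ∈ Finset.range n, u k) ≤
      2 * K * (2 * K)⁻¹ ^ n := by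
    intro n m hnm
    obtain ⟨j, rfl⟩ := Nat.exists_eq_add_of_le hnm
    rw [Finset.sum_range_add, add_sub_cancel_left]
    exact X.qnorm_sum_range_le hK1 hK hu j n
  have hlim : Tendsto (fun n => 2 * K * (2 * K)⁻¹ ^ n) atTop (𝓝 0) := by
    have : Tendsto (fun n => (2 * K)⁻¹ ^ n) atTop (𝓝 0) :=
      tendsto_pow_atTop_nhds_zero_of_lt_one (by positivity) (inv_lt_one_of_one_lt₀ (by linarith))
    simpa using this.const_mul (2 * K)
  obtain ⟨S, hS⟩ := X.complete (fun n => ∑ k ∈ Finset.range n, u k) (by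
    intro ε hε
    obtain ⟨N, hN⟩ := eventually_atTop.1 (hlim.eventually_lt_const hε)
    refine ⟨N, fun m hm n hn => ?_⟩
    rcases le_total n m with h | h
    · exact (htail n m h).trans_lt (hN n hn)
    · rw [← X.qnorm_neg, neg_sub]
      exact (htail m n h).trans_lt (hN m hm))
  refine ⟨S, ae_all_iff.2 fun n => ?_⟩
  have hle := X.le_of_tendsto_qnorm (fun n m hnm => by
    filter_upwards [X.coeFn_sum_range u n, X.coeFn_sum_range u m, ae_all_iff.2 hpos]
      with ω h1 h2 h3
    rw [h1, h2]
    exact Finset.sum_le_sum_of_subset_of_nonneg (Finset.range_mono hnm) fun i _ _ => h3 i) hS n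
  filter_upwards [hle, X.coeFn_sum_range u n] with ω h1 h2
  rwa [h2] at h1

/-- A version of the weak Fatou property. -/
theorem powNorm_ne_top_of_tendsto {r : ℝ} (hr : 0 < r) {F : ℕ → Ω → ℝ≥0} {f : Ω → ℝ≥0}
    (hFm : ∀ n, Measurable (F n)) (hfm : Measurable f)
    (hF : ∀ n, X.powNorm r (F n) ≠ ∞) (hmono : Monotone F)
    (hlim : ∀ ω, Tendsto (fun n => F n ω) atTop (𝓝 (f ω))) {a : ℕ → ℝ≥0∞}
    (hsub : ∀ n m, n ≤ m → X.powNorm r (F m - F n) ≤ a n) (ha : Tendsto a atTop (𝓝 0)) :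
    X.powNorm r f ≠ ∞ := by
  obtain ⟨K, hK1, hK⟩ := X.exists_one_le_qnorm_add_le
  have hdpos : ∀ k : ℕ, (0 : ℝ≥0∞) < ENNReal.ofReal ((4 * K)⁻¹ ^ k) ^ r := fun k =>
    ENNReal.rpow_pos (ENNReal.ofReal_pos.2 (by positivity)) ENNReal.ofReal_ne_top
  -- The rate (4K)⁻¹ leaves room for a factor 2^k on the k-th increment while keeping the rate
  -- (2K)⁻¹ required for an order bounded series.
  obtain ⟨φ, hφ, hφa⟩ := extraction_forall_of_eventually
    (P := fun k n => a n < ENNReal.ofReal ((4 * K)⁻¹ ^ k) ^ r)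
    (fun k => ha.eventually_lt_const (hdpos k))
  let D : ℕ → Ω → ℝ≥0 := fun k => F (φ (k + 1)) - F (φ k)
  have hDm : ∀ k, Measurable (D k) := fun k => (hFm _).sub (hFm _)
  have hDle : ∀ k, X.powNorm r (D k) ≤ ENNReal.ofReal ((4 * K)⁻¹ ^ k) ^ r := fun k =>
    (hsub _ _ (hφ.monotone (Nat.le_succ k))).trans (hφa k).le
  have hDfin : ∀ k, X.powNorm r (D k) ≠ ∞ := fun k => ne_top_of_le_ne_top
    (ENNReal.rpow_ne_top_of_nonneg hr.le ENNReal.ofReal_ne_top) (hDle k)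
  choose z hz using fun k => X.exists_ae_eq_of_powNorm_ne_top hr (hDfin k)
  have hzn : ∀ k, X.qnorm (z k) ≤ (4 * K)⁻¹ ^ k := by
    intro k
    have h := hDle k
    rw [X.powNorm_eq_of_ae_eq (z k) (hz k), ENNReal.rpow_le_rpow_iff hr] at h
    exact (ENNReal.ofReal_le_ofReal_iff (by positivity)).1 h
  obtain ⟨S, hS⟩ := X.exists_sum_range_le hK1 hK (u := fun k => (2 : ℝ) ^ k • z k)
    (fun k => by
      rw [X.qnorm_smul, abs_of_nonneg (by positivity)]
      calc (2 : ℝ) ^ k * X.qnorm (z k) ≤ 2 ^ k * (4 * K)⁻¹ ^ k := by gcongr; exact hzn k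
        _ = (2 * K)⁻¹ ^ k := by
          rw [← mul_pow]
          congr 1
          field_simp
          norm_num)
    (fun k => by
      filter_upwards [hz k, AEEqFun.coeFn_smul ((2 : ℝ) ^ k) (z k : Ω →ₘ[μ] ℝ)] with ω h1 h2
      rw [Submodule.coe_smul, h2, Pi.smul_apply, ← h1, smul_eq_mul]
      positivity)
  have hone : (2 : ℝ) ^ (-r) < 1 := Real.rpow_lt_one_of_one_lt_of_neg (by norm_num) (by linarith)
  set C : ℝ := (1 - 2 ^ (-r))⁻¹ with hC
  have hC0 : 0 ≤ C := inv_nonneg.2 (by linarith)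
  obtain ⟨y, hy⟩ := X.exists_ae_eq_of_powNorm_ne_top hr (hF (φ 0))
  rw [X.powNorm_ne_top_iff hr]
  refine X.mem_of_le (g := fun ω => 2 ^ (1 / r) * ((y : Ω →ₘ[μ] ℝ) ω +
    C ^ (1 / r) * (S : Ω →ₘ[μ] ℝ) ω))
    (QuasiKotheSpace.measurable_rpow_coe hfm _).aestronglyMeasurable ?_
    (X.mem_const_mul (X.mem_add (X.mem_iff_exists.2 ⟨y, ae_eq_rfl⟩)
      (X.mem_const_mul (X.mem_iff_exists.2 ⟨S, ae_eq_rfl⟩) _)) _)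
  filter_upwards [hS, hy, ae_all_iff.2 hz,
    ae_all_iff.2 fun k => AEEqFun.coeFn_smul ((2 : ℝ) ^ k) (z k : Ω →ₘ[μ] ℝ)] with ω h1 h2 h3 h4
  simp only [Submodule.coe_smul, h4, Pi.smul_apply, smul_eq_mul, ← h3] at h1
  rw [← h2]
  set s := (S : Ω →ₘ[μ] ℝ) ω
  have hs : 0 ≤ s := by simpa using h1 0
  -- Each single term 2^k D_k^{1/r} is at most s. Raising to the power r gives pointwise geometric
  -- decay, so the increments are summable whether r is above or below 1, with geometric constant C.
  have hDs : ∀ k, (D k ω : ℝ) ≤ (2 ^ (-r)) ^ k * s ^ r := by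
    intro k
    have h5 : (2 : ℝ) ^ k * (D k ω : ℝ) ^ (1 / r) ≤ s :=
      (Finset.single_le_sum (f := fun k => (2 : ℝ) ^ k * (D k ω : ℝ) ^ (1 / r))
        (fun i _ => by positivity) (Finset.self_mem_range_succ k)).trans (h1 (k + 1))
    have h6 := Real.rpow_le_rpow (by positivity) h5 hr.le
    rw [Real.mul_rpow (by positivity) (by positivity), ← Real.rpow_mul (by positivity),
      one_div_mul_cancel hr.ne', Real.rpow_one] at h6
    have h7 : ((2 : ℝ) ^ (-r)) ^ k * ((2 : ℝ) ^ k) ^ r = 1 := by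
      rw [← Real.rpow_natCast, ← Real.rpow_natCast, ← Real.rpow_mul (by norm_num),
        ← Real.rpow_mul (by norm_num), ← Real.rpow_add (by norm_num)]
      ring_nf
      simp
    calc (D k ω : ℝ) = (2 ^ (-r)) ^ k * (((2 : ℝ) ^ k) ^ r * D k ω) := by
          rw [← mul_assoc, h7, one_mul]
      _ ≤ _ := by gcongr
  have hFs : ∀ n, (F (φ n) ω : ℝ) = F (φ 0) ω + ∑ k ∈ Finset.range n, (D k ω : ℝ) := by
    intro n
    induction n with
    | zero => simp
    | succ n ih =>
      rw [Finset.sum_range_succ, ← add_assoc, ← ih]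
      simp only [D, Pi.sub_apply]
      rw [NNReal.coe_sub (hmono (hφ.monotone (Nat.le_succ n)) ω)]
      ring
  have hFle : ∀ n, (F (φ n) ω : ℝ) ≤ F (φ 0) ω + C * s ^ r := by
    intro n
    rw [hFs]
    gcongr
    refine (Finset.sum_le_sum fun k _ => hDs k).trans ?_
    rw [← Finset.sum_mul]
    gcongr
    rw [hC, ← tsum_geometric_of_lt_one (by positivity) hone]
    exact (summable_geometric_of_lt_one (by positivity) hone).sum_le_tsum _
      fun i _ => by positivity
  have hfle : (f ω : ℝ) ≤ F (φ 0) ω + C * s ^ r :=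
    le_of_tendsto' ((NNReal.tendsto_coe.2 (hlim ω)).comp hφ.tendsto_atTop) hFle
  rw [abs_of_nonneg (by positivity), abs_of_nonneg (by positivity)]
  calc (f ω : ℝ) ^ (1 / r) ≤ (F (φ 0) ω + C * s ^ r) ^ (1 / r) :=
        Real.rpow_le_rpow (by positivity) hfle (by positivity)
    _ ≤ 2 ^ (1 / r) * ((F (φ 0) ω : ℝ) ^ (1 / r) + (C * s ^ r) ^ (1 / r)) :=
        QuasiKotheSpace.rpow_add_le_two_rpow_mul (by positivity) (by positivity) (by positivity)
    _ = _ := by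
        rw [Real.mul_rpow hC0 (by positivity), ← Real.rpow_mul hs, mul_one_div_cancel hr.ne',
          Real.rpow_one]

end QuasiBanachFunctionSpace

/-! ### Weights on convex and on concave spaces -/

/-- Coefficients are absorbed into the generators, which turns membership in a generated cone into
the finite families appearing in convexity, concavity and the inequality for T. -/
theorem exists_sum_of_mem_span {M : Type*} [AddCommMonoid M] [Module ℝ≥0 M] {G : Set M}
    (hG : ∀ (c : ℝ≥0), ∀ g ∈ G, c • g ∈ G) {x : M} (hx : x ∈ Submodule.span ℝ≥0 G) :
    ∃ (n : ℕ) (g : Fin n → M), (∀ k, g k ∈ G) ∧ ∑ k, g k = x := by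
  obtain ⟨n, c, g, rfl⟩ := Submodule.mem_span_set'.1 hx
  exact ⟨n, fun k => c k • (g k : M), fun k => hG _ _ (g k).2, rfl⟩

theorem measurable_fin_sum {Ω : Type*} [MeasurableSpace Ω] {n : ℕ} {f : Fin n → Ω → ℝ≥0}
    (hf : ∀ k, Measurable (f k)) : Measurable (∑ k, f k) := by
  convert Finset.measurable_sum Finset.univ (fun i _ => hf i) using 1
  ext ω
  rw [Finset.sum_apply]

namespace QuasiKotheSpace

variable {Ω : Type*} [MeasurableSpace Ω] {μ : Measure Ω}

/-- The pairs `(f, a ‖f^{1/r}‖^r)` with `f^{1/r}` in the space. -/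
def powNormPairs (X : QuasiKotheSpace μ) (r : ℝ) (a : ℝ≥0) : Set ((Ω → ℝ≥0) × ℝ≥0) :=
  {u | Measurable u.1 ∧ X.powNorm r u.1 ≠ ∞ ∧ (u.2 : ℝ≥0∞) = a * X.powNorm r u.1}

/-- The cone generated by `powNormPairs`. -/
noncomputable def powNormCone (X : QuasiKotheSpace μ) (r : ℝ) (a : ℝ≥0) :
    Submodule ℝ≥0 ((Ω → ℝ≥0) × ℝ≥0) :=
  Submodule.span ℝ≥0 (X.powNormPairs r a)

variable (X : QuasiKotheSpace μ) {r : ℝ}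

theorem smul_mem_powNormPairs (hr : 0 < r) (a c : ℝ≥0) :
    ∀ g ∈ X.powNormPairs r a, c • g ∈ X.powNormPairs r a := by
  rintro ⟨f, α⟩ ⟨h1, h2, h3⟩
  have h4 := X.powNorm_smul hr h2 c
  refine ⟨h1.const_smul c, ?_, ?_⟩
  · rw [Prod.smul_fst, h4]
    exact ENNReal.mul_ne_top ENNReal.coe_ne_top h2
  · rw [Prod.smul_fst, h4, Prod.smul_snd, smul_eq_mul, ENNReal.coe_mul, h3]
    ring

theorem exists_of_mem_powNormCone (hr : 0 < r) {a : ℝ≥0} {u : (Ω → ℝ≥0) × ℝ≥0}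
    (hu : u ∈ X.powNormCone r a) :
    ∃ (n : ℕ) (f : Fin n → Ω → ℝ≥0), (∀ k, Measurable (f k)) ∧ (∀ k, X.powNorm r (f k) ≠ ∞) ∧
      u.1 = ∑ k, f k ∧ (u.2 : ℝ≥0∞) = a * ∑ k, X.powNorm r (f k) := by
  obtain ⟨n, g, hg, rfl⟩ := exists_sum_of_mem_span (X.smul_mem_powNormPairs hr a) hu
  refine ⟨n, fun k => (g k).1, fun k => (hg k).1, fun k => (hg k).2.1, Prod.fst_sum, ?_⟩
  rw [Prod.snd_sum, ENNReal.ofNNReal_finsetSum, Finset.mul_sum]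
  exact Finset.sum_congr rfl fun k _ => (hg k).2.2

theorem measurable_of_mem_powNormCone (hr : 0 < r) {a : ℝ≥0} {u : (Ω → ℝ≥0) × ℝ≥0}
    (hu : u ∈ X.powNormCone r a) : Measurable u.1 := by
  obtain ⟨n, f, h1, -, h3, -⟩ := X.exists_of_mem_powNormCone hr hu
  rw [h3]
  exact measurable_fin_sum h1

theorem powNorm_ne_top_of_mem_powNormCone (hr : 0 < r) {a : ℝ≥0} {u : (Ω → ℝ≥0) × ℝ≥0}
    (hu : u ∈ X.powNormCone r a) : X.powNorm r u.1 ≠ ∞ := by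
  obtain ⟨n, f, h1, h2, h3, -⟩ := X.exists_of_mem_powNormCone hr hu
  rw [h3]
  exact X.powNorm_sum_ne_top hr _ h1 h2

theorem coe_rpow_eq (hr : 0 < r) (c : ℝ≥0) : ((c ^ r : ℝ≥0) : ℝ≥0∞) = (c : ℝ≥0∞) ^ r :=
  ENNReal.coe_rpow_of_nonneg c hr.le

theorem powNorm_le_of_mem_powNormCone (hr : 0 < r) {c : ℝ≥0} (hc : X.ConvexWith r c)
    {u : (Ω → ℝ≥0) × ℝ≥0} (hu : u ∈ X.powNormCone r (c ^ r)) : X.powNorm r u.1 ≤ u.2 := by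
  obtain ⟨n, f, -, h2, h3, h4⟩ := X.exists_of_mem_powNormCone hr hu
  rw [h3, h4, coe_rpow_eq hr]
  exact X.powNorm_sum_le hr hc h2

theorem le_powNorm_of_mem_powNormCone (hr : 0 < r) {c : ℝ≥0} (hc : X.ConcaveWith r c)
    {u : (Ω → ℝ≥0) × ℝ≥0} (hu : u ∈ X.powNormCone r (c ^ r)⁻¹) : u.2 ≤ X.powNorm r u.1 := by
  obtain ⟨n, f, -, h2, h3, h4⟩ := X.exists_of_mem_powNormCone hr hu
  rw [h3, h4]
  refine (mul_le_mul_right (X.sum_powNorm_le hr hc h2) _).trans ?_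
  rw [← coe_rpow_eq hr, ← mul_assoc, ← ENNReal.coe_mul]
  refine mul_le_of_le_one_left zero_le ?_
  exact_mod_cast inv_mul_le_one

theorem mk_mem_powNormCone (a : ℝ≥0) {f : Ω → ℝ≥0} (hf : Measurable f)
    (hf' : X.powNorm r f ≠ ∞) :
    (f, a * (X.powNorm r f).toNNReal) ∈ X.powNormCone r a :=
  Submodule.subset_span ⟨hf, hf', by rw [ENNReal.coe_mul, ENNReal.coe_toNNReal hf']⟩

/-- The weight on an `r`-convex σ-order continuous space. -/
theorem exists_weight_of_convexWith [SigmaFinite μ] (hr : 0 < r) {c : ℝ≥0}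
    (hc : X.ConvexWith r c) (hX : X.IsSigmaOrderContinuous)
    (L : Submodule ℝ≥0 ((Ω → ℝ≥0) × ℝ≥0)) (hLm : ∀ l ∈ L, Measurable l.1)
    (hLX : ∀ l ∈ L, (l.2 : ℝ≥0∞) ≤ X.powNorm r l.1) :
    ∃ w : Ω → ℝ≥0, Measurable w ∧
      (∀ f, Measurable f → X.powNorm r f ≠ ∞ →
        ∫⁻ ω, f ω * w ω ∂μ ≤ (c : ℝ≥0∞) ^ r * X.powNorm r f) ∧
      ∀ l ∈ L, X.powNorm r l.1 ≠ ∞ → l.2 ≤ ∫⁻ ω, l.1 ω * w ω ∂μ := by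
  set U := X.powNormCone r (c ^ r) with hU
  have hD : ∀ f, Measurable f → X.powNorm r f ≠ ∞ → Dominated μ U f := fun f hf hf' =>
    ⟨hf, _, X.mk_mem_powNormCone (c ^ r) hf hf', by rfl⟩
  have hD' : ∀ f, Dominated μ U f → X.powNorm r f ≠ ∞ := by
    rintro f ⟨hf, u, hu, hfu⟩
    exact ne_top_of_le_ne_top (X.powNorm_ne_top_of_mem_powNormCone hr hu)
      (X.powNorm_mono hr hf hfu)
  obtain ⟨ψ, hadd, hsmul, hmono, hψU, hψL⟩ := exists_additive_between (μ := μ) (U := U) (L := L)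
    (fun u hu => X.measurable_of_mem_powNormCone hr hu)
    (fun l hl u hu hlu => by
      have := ((hLX l hl).trans (X.powNorm_mono hr (hLm l hl) hlu)).trans
        (X.powNorm_le_of_mem_powNormCone hr hc hu)
      exact_mod_cast this)
  have hψ : IsPositiveOn μ U ψ := ⟨hadd, hsmul, hmono⟩
  have hψle : ∀ f, Dominated μ U f → (ψ f : ℝ≥0∞) ≤ (c : ℝ≥0∞) ^ r * X.powNorm r f := by
    intro f hf
    have := hψU _ (X.mk_mem_powNormCone (c ^ r) hf.1 (hD' f hf))
    rw [← ENNReal.coe_toNNReal (hD' f hf), ← coe_rpow_eq hr]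
    exact_mod_cast this
  obtain ⟨-, v, hvm, -, -, -, -, hvfin, hvle, hvapp⟩ := exists_density hψ
  have hint : ∀ f : Ω → ℝ≥0, ∫⁻ ω, f ω * ((v ω).toNNReal : ℝ≥0) ∂μ = ∫⁻ ω, f ω * v ω ∂μ := by
    intro f
    refine lintegral_congr_ae ?_
    filter_upwards [hvfin] with ω h
    rw [ENNReal.coe_toNNReal h.ne]
  refine ⟨fun ω => (v ω).toNNReal, hvm.ennreal_toNNReal, fun f hf hf' => ?_, fun l hl hl' => ?_⟩
  · rw [hint]
    exact (hvle f (hD f hf hf')).trans (hψle f (hD f hf hf'))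
  · rw [hint]
    have hd := hD l.1 (hLm l hl) hl'
    refine (ENNReal.coe_le_coe.2 (hψL l hl hd)).trans ?_
    -- Split l = F n + (l - F n). On F n, ψ is at most the integral of l plus ε; on l - F n ↓ 0 it
    -- is at most c^r ‖(l - F n)^{1/r}‖^r, which tends to 0 by σ-order continuity.
    refine ENNReal.le_of_forall_pos_le_add fun ε hε _ => ?_
    obtain ⟨F, hF1, hF2, hF3, hF4⟩ := hvapp l.1 hd ε hε
    have hle : ∀ n, F n ≤ l.1 := fun n ω =>
      Monotone.ge_of_tendsto (fun a b hab => hF2 hab ω) (hF3 ω) n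
    have hdm : ∀ n, Dominated μ U (l.1 - F n) := fun n =>
      hd.mono (hd.1.sub (hF1 n).1) (ae_of_all _ fun ω => tsub_le_self)
    have h0 := X.tendsto_powNorm_zero hr hX (F := fun n => l.1 - F n)
      (fun n => hD' _ (hdm n)) (fun n m hnm => tsub_le_tsub_left (hF2 hnm) _)
      (fun ω => by simpa using (tendsto_const_nhds (x := l.1 ω)).sub (hF3 ω))
    have h1 : Tendsto (fun n => (∫⁻ ω, l.1 ω * v ω ∂μ + ε) +
        (c : ℝ≥0∞) ^ r * X.powNorm r (l.1 - F n)) atTop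
        (𝓝 ((∫⁻ ω, l.1 ω * v ω ∂μ + ε) + (c : ℝ≥0∞) ^ r * 0)) :=
      tendsto_const_nhds.add (ENNReal.Tendsto.const_mul h0
        (Or.inr (ENNReal.rpow_ne_top_of_nonneg hr.le ENNReal.coe_ne_top)))
    rw [mul_zero, add_zero] at h1
    refine ge_of_tendsto' h1 fun n => ?_
    have e : l.1 = F n + (l.1 - F n) := (add_tsub_cancel_of_le (hle n)).symm
    calc (ψ l.1 : ℝ≥0∞) = ψ (F n) + ψ (l.1 - F n) := by
          conv_lhs => rw [e]
          rw [hadd _ _ (hF1 n) (hdm n), ENNReal.coe_add]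
      _ ≤ _ := add_le_add (hF4 n) (hψle _ (hdm n))

end QuasiKotheSpace

namespace QuasiBanachFunctionSpace

variable {Ω : Type*} [MeasurableSpace Ω] {μ : Measure Ω}

theorem toNNReal_inv_mul_le_one (v : ℝ≥0∞) : ((v⁻¹).toNNReal : ℝ≥0∞) * v ≤ 1 := by
  rcases eq_or_ne v 0 with rfl | h
  · simp
  · rw [ENNReal.coe_toNNReal (ENNReal.inv_ne_top.2 h)]
    exact ENNReal.inv_mul_le_one v

/-- The weight on an `r`-concave space. -/
theorem exists_weight_of_concaveWith [SigmaFinite μ] (Y : QuasiBanachFunctionSpace μ) {r : ℝ}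
    (hr : 0 < r) {c : ℝ≥0} (hc : Y.ConcaveWith r c)
    (U : Submodule ℝ≥0 ((Ω → ℝ≥0) × ℝ≥0)) (hUm : ∀ u ∈ U, Measurable u.1)
    (hUfin : ∀ u ∈ U, Y.powNorm r u.1 ≠ ∞)
    (hLU : ∀ l ∈ Y.powNormCone r (c ^ r)⁻¹, ∀ u ∈ U, l.1 ≤ᵐ[μ] u.1 → l.2 ≤ u.2) :
    ∃ w : Ω → ℝ≥0, Measurable w ∧
      (∀ h : Ω → ℝ≥0, Measurable h → ∫⁻ ω, h ω ∂μ ≠ ∞ →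
        Y.powNorm r (w * h) ≤ (c : ℝ≥0∞) ^ r * ∫⁻ ω, h ω ∂μ) ∧
      ∀ u ∈ U, ∫⁻ ω, (u.1 ω : ℝ≥0∞) / w ω ∂μ ≤ u.2 := by
  obtain ⟨ψ, hadd, hsmul, hmono, hψU, hψL⟩ := exists_additive_between hUm hLU
  have hψ : IsPositiveOn μ U ψ := ⟨hadd, hsmul, hmono⟩
  obtain ⟨B, v, hvm, hB1, hB2, hB3, hB4, hvfin, hvle, hvapp⟩ := exists_density hψ
  have hBm : MeasurableSet (⋃ n, B n) := MeasurableSet.iUnion hB2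
  have hfin : ∀ f, Dominated μ U f → Y.powNorm r f ≠ ∞ := by
    rintro f ⟨hf, u, hu, hfu⟩
    exact ne_top_of_le_ne_top (hUfin u hu) (Y.powNorm_mono hr hf hfu)
  have hcr : (c : ℝ≥0∞) ^ r ≠ ∞ := ENNReal.rpow_ne_top_of_nonneg hr.le ENNReal.coe_ne_top
  have key : ∀ g, Dominated μ U g →
      Y.powNorm r g ≤ (c : ℝ≥0∞) ^ r * ∫⁻ ω, g ω * v ω ∂μ := by
    intro g hg
    -- For c = 0 the factor (c^r)⁻¹ is 0 by convention and the sandwich says nothing, but concavity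
    -- with constant 0 makes the quasi norm vanish.
    rcases eq_or_ne c 0 with rfl | hc0
    · have := Y.sum_powNorm_le hr hc (n := 1) (f := fun _ => g) fun _ => hfin g hg
      simpa [ENNReal.zero_rpow_of_pos hr] using this
    have hcr0 : (c ^ r : ℝ≥0) ≠ 0 := (NNReal.rpow_pos (pos_iff_ne_zero.2 hc0)).ne'
    have h1 : ∀ f, Dominated μ U f → Y.powNorm r f ≤ (c : ℝ≥0∞) ^ r * ψ f := by
      intro f hf
      have := hψL _ (Y.mk_mem_powNormCone (c ^ r)⁻¹ hf.1 (hfin f hf)) hf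
      simp only at this
      rw [inv_mul_le_iff₀ (pos_iff_ne_zero.2 hcr0)] at this
      rw [← QuasiKotheSpace.coe_rpow_eq hr, ← ENNReal.coe_mul, ← ENNReal.coe_toNNReal (hfin f hf)]
      exact ENNReal.coe_le_coe.2 this
    -- The Fatou property carries the lower bound on ψ over to its countably additive part.
    have h2 : ∀ ε : ℝ≥0, 0 < ε →
        Y.powNorm r g ≤ (c : ℝ≥0∞) ^ r * (∫⁻ ω, g ω * v ω ∂μ + ε) := by
      intro ε hε
      obtain ⟨F, hF1, hF2, hF3, hF4⟩ := hvapp g hg ε hε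
      refine le_of_tendsto' (Y.tendsto_powNorm_of_monotone hr (fun n => hfin _ (hF1 n))
        (hfin g hg) hF2 hF3) fun n => (h1 _ (hF1 n)).trans ?_
      gcongr
      exact hF4 n
    have h3 : ∀ ε : ℝ≥0, 0 < ε →
        Y.powNorm r g / (c : ℝ≥0∞) ^ r ≤ ∫⁻ ω, g ω * v ω ∂μ + ε := fun ε hε =>
      ENNReal.div_le_of_le_mul' (h2 ε hε)
    have h4 : Y.powNorm r g / (c : ℝ≥0∞) ^ r ≤ ∫⁻ ω, g ω * v ω ∂μ :=
      ENNReal.le_of_forall_pos_le_add fun ε hε _ => h3 ε hε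
    rwa [ENNReal.div_le_iff_le_mul (Or.inl ?_) (Or.inl hcr), mul_comm] at h4
    rw [← QuasiKotheSpace.coe_rpow_eq hr]
    exact ENNReal.coe_ne_zero.2 hcr0
  -- By `key`, the indicator of the zero set of v inside B n has quasi norm 0, so this set is null.
  have hvpos : ∀ᵐ ω ∂μ, ω ∈ ⋃ n, B n → v ω ≠ 0 := by
    have h1 : ∀ n, ∀ᵐ ω ∂μ, ω ∈ B n → v ω ≠ 0 := by
      intro n
      have hZ : MeasurableSet (B n ∩ {ω | v ω = 0}) :=
        (hB2 n).inter (hvm (measurableSet_singleton 0))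
      have hd := (hB3 n).indicator_subset hZ Set.inter_subset_left
      have h2 := key _ hd
      have h3 : ∫⁻ ω, (((B n ∩ {ω | v ω = 0}).indicator (1 : Ω → ℝ≥0) ω : ℝ≥0) : ℝ≥0∞) * v ω ∂μ = 0 := by
        rw [← lintegral_zero (μ := μ)]
        refine lintegral_congr fun ω => ?_
        by_cases h : ω ∈ B n ∩ {ω | v ω = 0}
        · rw [show v ω = 0 from h.2, mul_zero]
        · simp [Set.indicator_of_notMem h]
      rw [h3, mul_zero, nonpos_iff_eq_zero] at h2
      filter_upwards [Y.ae_eq_zero_of_powNorm_eq_zero hr h2] with ω h4 h5 h6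
      rw [Set.indicator_of_mem (show ω ∈ B n ∩ {ω | v ω = 0} from ⟨h5, h6⟩)] at h4
      simp at h4
    filter_upwards [ae_all_iff.2 h1] with ω h2 h3
    obtain ⟨n, hn⟩ := Set.mem_iUnion.1 h3
    exact h2 n hn
  -- The weight is 1/v on the support of U and 0 elsewhere; `toNNReal` affects only points where v =
  -- 0, which form a null subset of the support.
  refine ⟨(⋃ n, B n).indicator fun ω => (v ω)⁻¹.toNNReal,
    hvm.inv.ennreal_toNNReal.indicator hBm, fun h hh hhfin => ?_, fun u hu => ?_⟩
  · set f : Ω → ℝ≥0 := ((⋃ n, B n).indicator fun ω => (v ω)⁻¹.toNNReal) * h with hf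
    have hfm : Measurable f := (hvm.inv.ennreal_toNNReal.indicator hBm).mul hh
    have hfv : ∀ ω, (f ω : ℝ≥0∞) * v ω ≤ h ω := by
      intro ω
      by_cases hω : ω ∈ ⋃ n, B n
      · rw [hf, Pi.mul_apply, Set.indicator_of_mem hω, ENNReal.coe_mul, mul_right_comm]
        exact mul_le_of_le_one_left zero_le (toNNReal_inv_mul_le_one _)
      · rw [hf, Pi.mul_apply, Set.indicator_of_notMem hω]
        simp
    have hfint : ∫⁻ ω, f ω * v ω ∂μ ≤ ∫⁻ ω, h ω ∂μ := lintegral_mono hfv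
    -- The product of weight and h need not be dominated by U, so `key` is applied to truncations:
    -- bounded by n and supported in B n.
    let F : ℕ → Ω → ℝ≥0 := fun n => (B n).indicator fun ω => min (f ω) n
    have hFm : ∀ n, Measurable (F n) := fun n => (hfm.min measurable_const).indicator (hB2 n)
    have hFD : ∀ n, Dominated μ U (F n) := fun n =>
      ((hB3 n).smul (n : ℝ≥0)).mono (hFm n) (ae_of_all _ fun ω => by
        by_cases hω : ω ∈ B n <;> simp [F, hω])
    have hFmono : Monotone F := by
      intro n m hnm ω
      by_cases hω : ω ∈ B n
      · simp only [F, Set.indicator_of_mem hω, Set.indicator_of_mem (hB1 hnm hω)]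
        exact min_le_min_left _ (by exact_mod_cast hnm)
      · simp [F, Set.indicator_of_notMem hω]
    have hFle : ∀ n, F n ≤ f := fun n ω => by
      by_cases hω : ω ∈ B n <;> simp [F, hω]
    have hFlim : ∀ ω, Tendsto (fun n => F n ω) atTop (𝓝 (f ω)) := by
      intro ω
      by_cases hω : ω ∈ ⋃ n, B n
      · obtain ⟨N, hN⟩ := Set.mem_iUnion.1 hω
        obtain ⟨M, hM⟩ := exists_nat_ge (f ω)
        refine tendsto_const_nhds.congr' ?_
        filter_upwards [eventually_ge_atTop N, eventually_ge_atTop M] with n h1 h2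
        simp only [F, Set.indicator_of_mem (hB1 h1 hN)]
        exact (min_eq_left (hM.trans (by exact_mod_cast h2))).symm
      · have h0 : f ω = 0 := by
          rw [hf, Pi.mul_apply, Set.indicator_of_notMem hω, zero_mul]
        have h1 : ∀ n, F n ω = 0 := fun n => le_antisymm ((hFle n ω).trans_eq h0) zero_le
        simp [h0, h1]
    have ha : Tendsto (fun n => (c : ℝ≥0∞) ^ r * ∫⁻ ω, ((f - F n) ω : ℝ≥0) * v ω ∂μ) atTop
        (𝓝 0) := by
      rw [← mul_zero ((c : ℝ≥0∞) ^ r), ← lintegral_zero (μ := μ)]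
      refine ENNReal.Tendsto.const_mul ?_ (Or.inr hcr)
      refine tendsto_lintegral_of_dominated_convergence (fun ω => (h ω : ℝ≥0∞))
        (fun n => (hfm.sub (hFm n)).coe_nnreal_ennreal.mul hvm) (fun n => ?_) hhfin ?_
      · refine ae_of_all _ fun ω => le_trans ?_ (hfv ω)
        have : (f - F n) ω ≤ f ω := tsub_le_self
        beta_reduce
        gcongr
      · filter_upwards [hvfin] with ω hω
        have h1 : Tendsto (fun n => (f - F n) ω) atTop (𝓝 0) := by
          simpa using (tendsto_const_nhds (x := f ω)).sub (hFlim ω)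
        have h2 := ENNReal.Tendsto.mul_const (ENNReal.tendsto_coe.2 h1) (b := v ω)
          (Or.inr hω.ne)
        simpa using h2
    -- The Fatou property presupposes a limit in the space. Membership comes from completeness: by
    -- `key` the increments F m - F n are controlled by ∫ (f - F n) v, which tends to 0 by dominated
    -- convergence.
    have hftop := Y.powNorm_ne_top_of_tendsto hr hFm hfm (fun n => hfin _ (hFD n)) hFmono hFlim
      (fun n m hnm => by
        have hd : Dominated μ U (F m - F n) :=
          (hFD m).mono ((hFm m).sub (hFm n)) (ae_of_all _ fun ω => tsub_le_self)
        refine (key _ hd).trans ?_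
        gcongr with ω
        exact tsub_le_tsub_right (hFle m ω) _) ha
    refine le_of_tendsto' (Y.tendsto_powNorm_of_monotone hr (fun n => hfin _ (hFD n)) hftop
      hFmono hFlim) fun n => (key _ (hFD n)).trans ?_
    refine mul_le_mul_right (le_trans (lintegral_mono fun ω => ?_) hfint) _
    gcongr
    exact hFle n ω
  · have hd : Dominated μ U u.1 := ⟨hUm u hu, u, hu, by rfl⟩
    refine le_trans (lintegral_mono_ae ?_) ((hvle u.1 hd).trans (ENNReal.coe_le_coe.2 (hψU u hu)))
    filter_upwards [hB4 u.1 hd, hvpos] with ω h1 h2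
    by_cases hω : ω ∈ ⋃ n, B n
    · rw [Set.indicator_of_mem hω, ENNReal.coe_toNNReal (ENNReal.inv_ne_top.2 (h2 hω)),
        div_eq_mul_inv, inv_inv]
    -- Off the support u vanishes a.e., and the quotient is 0/0 = 0.
    · rw [h1 hω]
      simp

end QuasiBanachFunctionSpace

namespace QuasiKotheSpace

variable {Ω : Type*} [MeasurableSpace Ω] {μ : Measure Ω} (X : QuasiKotheSpace μ)

theorem eNorm_abs {y : Ω → ℝ} (hy : AEStronglyMeasurable y μ) :
    X.eNorm (fun ω => |y ω|) = X.eNorm y :=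
  le_antisymm (X.eNorm_mono hy.norm (ae_of_all _ fun ω => by simp))
    (X.eNorm_mono hy (ae_of_all _ fun ω => by simp))

theorem coe_toNNReal_abs_rpow_rpow {r : ℝ} (hr : 0 < r) (a : ℝ) :
    (((|a| ^ r).toNNReal : ℝ≥0) : ℝ) ^ (1 / r) = |a| := by
  rw [Real.coe_toNNReal _ (by positivity), ← Real.rpow_mul (abs_nonneg a),
    mul_one_div_cancel hr.ne', Real.rpow_one]

theorem powNorm_abs_rpow {r : ℝ} (hr : 0 < r) {y : Ω → ℝ} (hy : AEStronglyMeasurable y μ) :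
    X.powNorm r (fun ω => (|y ω| ^ r).toNNReal) = X.eNorm y ^ r := by
  rw [powNorm]
  simp_rw [coe_toNNReal_abs_rpow_rpow hr]
  rw [X.eNorm_abs hy]

end QuasiKotheSpace

theorem coe_toNNReal_abs_rpow {r : ℝ} (hr : 0 < r) (a : ℝ) :
    ((|a| ^ r).toNNReal : ℝ≥0∞) = ‖a‖ₑ ^ r := by
  rw [← ofReal_norm, ENNReal.ofReal_rpow_of_nonneg (norm_nonneg a) hr.le]
  rfl

theorem eLpNorm_rpow_eq {Ω : Type*} [MeasurableSpace Ω] {μ : Measure Ω} {r : ℝ} (hr : 0 < r)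
    (y : Ω → ℝ) : eLpNorm y (ENNReal.ofReal r) μ ^ r = ∫⁻ ω, ‖y ω‖ₑ ^ r ∂μ := by
  rw [eLpNorm_eq_lintegral_rpow_enorm_toReal (by simpa using hr) ENNReal.ofReal_ne_top,
    ENNReal.toReal_ofReal hr.le, ← ENNReal.rpow_mul, one_div_mul_cancel hr.ne', ENNReal.rpow_one]

/-! ### The cone generated by the graph of T -/

section graph

variable {𝕜 Ω Ω' E F : Type*} [RCLike 𝕜]
  [MeasurableSpace Ω] {μ : Measure Ω} [MeasurableSpace Ω'] {ν : Measure Ω'}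
  [AddCommGroup E] [Module 𝕜 E] [TopologicalSpace E] {normE : QuasiBanachNorm 𝕜 E}
  [AddCommGroup F] [Module 𝕜 F] [TopologicalSpace F] {normF : QuasiBanachNorm 𝕜 F}
  {X : QuasiKotheSpace μ} {Y : QuasiKotheSpace ν}

/-- The pairs of measurable functions `(‖x‖^r, ‖Tx‖^r)`. -/
def rpowNormGraph (r : ℝ) (T : X.vectorValued normE → Y.vectorValued normF) :
    Set ((Ω → ℝ≥0) × (Ω' → ℝ≥0)) :=
  {t | Measurable t.1 ∧ Measurable t.2 ∧ ∃ x : X.vectorValued normE,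
    (∀ᵐ ω ∂μ, (t.1 ω : ℝ) = normE ((x : Ω →ₘ[μ] E) ω) ^ r) ∧
    ∀ᵐ ω ∂ν, (t.2 ω : ℝ) = normF ((T x : Ω' →ₘ[ν] F) ω) ^ r}

/-- The cone generated by the pairs `(‖x‖^r, ‖Tx‖^r)`. -/
noncomputable def rpowNormCone (r : ℝ) (T : X.vectorValued normE → Y.vectorValued normF) :
    Submodule ℝ≥0 ((Ω → ℝ≥0) × (Ω' → ℝ≥0)) :=
  Submodule.span ℝ≥0 (rpowNormGraph r T)

theorem exists_measurable_eq_rpow_norm {N : QuasiBanachNorm 𝕜 E} {x : Ω →ₘ[μ] E}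
    (hx : x ∈ X.vectorValued N) (r : ℝ) :
    ∃ f : Ω → ℝ≥0, Measurable f ∧ ∀ᵐ ω ∂μ, (f ω : ℝ) = N (x ω) ^ r := by
  obtain ⟨h, -⟩ := hx
  refine ⟨fun ω => (h.mk _ ω ^ r).toNNReal,
    (h.stronglyMeasurable_mk.measurable.pow_const r).real_toNNReal, ?_⟩
  filter_upwards [h.ae_eq_mk] with ω hω
  rw [← hω, Real.coe_toNNReal _ (Real.rpow_nonneg (N.nonneg _) _)]

theorem exists_mem_rpowNormGraph (r : ℝ) (T : X.vectorValued normE → Y.vectorValued normF)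
    (x : X.vectorValued normE) :
    ∃ t ∈ rpowNormGraph r T, (∀ᵐ ω ∂μ, (t.1 ω : ℝ) = normE ((x : Ω →ₘ[μ] E) ω) ^ r) ∧
      ∀ᵐ ω ∂ν, (t.2 ω : ℝ) = normF ((T x : Ω' →ₘ[ν] F) ω) ^ r := by
  obtain ⟨f, hf1, hf2⟩ := exists_measurable_eq_rpow_norm x.2 r
  obtain ⟨g, hg1, hg2⟩ := exists_measurable_eq_rpow_norm (T x).2 r
  exact ⟨(f, g), ⟨hf1, hg1, x, hf2, hg2⟩, hf2, hg2⟩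

theorem powNorm_ne_top_of_vectorValued {r : ℝ} (hr : 0 < r) {N : QuasiBanachNorm 𝕜 E}
    {x : Ω →ₘ[μ] E} (hx : x ∈ X.vectorValued N) {f : Ω → ℝ≥0}
    (hf : ∀ᵐ ω ∂μ, (f ω : ℝ) = N (x ω) ^ r) : X.powNorm r f ≠ ∞ := by
  rw [X.powNorm_ne_top_iff hr, ← QuasiKotheSpace.eNorm_ne_top_iff,
    X.eNorm_congr (g := fun ω => N (x ω)), QuasiKotheSpace.eNorm_ne_top_iff]
  · exact hx
  · filter_upwards [hf] with ω hω
    rw [hω, ← Real.rpow_mul (N.nonneg _), mul_one_div_cancel hr.ne', Real.rpow_one]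

theorem rpow_norm_smul {N : QuasiBanachNorm 𝕜 E} {r : ℝ} (hr : 0 < r) (c : ℝ≥0) (x : E) :
    N ((((c ^ (1 / r) : ℝ≥0) : ℝ) : 𝕜) • x) ^ r = c * N x ^ r := by
  rw [N.smul, RCLike.norm_ofReal, abs_of_nonneg (NNReal.coe_nonneg _),
    Real.mul_rpow (NNReal.coe_nonneg _) (N.nonneg _), ← NNReal.coe_rpow, ← NNReal.rpow_mul,
    one_div_mul_cancel hr.ne', NNReal.rpow_one]

/-- Scaling r-th powers of norms by c amounts to scaling x by c^{1/r}; T commutes with this by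
homogeneity. -/
theorem smul_mem_rpowNormGraph [ContinuousSMul 𝕜 E] [ContinuousSMul 𝕜 F] {r : ℝ} (hr : 0 < r)
    {T : X.vectorValued normE → Y.vectorValued normF}
    (hT : ∀ (c : ℝ≥0) (x : X.vectorValued normE),
      T (X.scale normE c x) = Y.scale normF c (T x)) (c : ℝ≥0) :
    ∀ t ∈ rpowNormGraph r T, c • t ∈ rpowNormGraph r T := by
  rintro t ⟨h1, h2, x, h3, h4⟩
  refine ⟨h1.const_smul c, h2.const_smul c, X.scale normE (c ^ (1 / r)) x, ?_, ?_⟩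
  · filter_upwards [h3, AEEqFun.coeFn_smul ((((c ^ (1 / r) : ℝ≥0) : ℝ) : 𝕜)) (x : Ω →ₘ[μ] E)]
      with ω h5 h6
    rw [QuasiKotheSpace.scale, h6, Pi.smul_apply, rpow_norm_smul hr, ← h5]
    rfl
  · rw [hT]
    filter_upwards [h4, AEEqFun.coeFn_smul ((((c ^ (1 / r) : ℝ≥0) : ℝ) : 𝕜))
      (T x : Ω' →ₘ[ν] F)] with ω h5 h6
    rw [QuasiKotheSpace.scale, h6, Pi.smul_apply, rpow_norm_smul hr, ← h5]
    rfl

theorem eNorm_rpow_sum_eq_powNorm {r : ℝ} {N : QuasiBanachNorm 𝕜 E} {n : ℕ}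
    {x : Fin n → Ω →ₘ[μ] E} {f : Fin n → Ω → ℝ≥0}
    (hf : ∀ k, ∀ᵐ ω ∂μ, (f k ω : ℝ) = N (x k ω) ^ r) :
    X.eNorm (fun ω => (∑ k, N (x k ω) ^ r) ^ (1 / r)) ^ r = X.powNorm r (∑ k, f k) := by
  rw [QuasiKotheSpace.powNorm]
  congr 1
  refine X.eNorm_congr ?_
  filter_upwards [ae_all_iff.2 hf] with ω h
  rw [Finset.sum_apply, NNReal.coe_sum]
  simp_rw [h]

theorem powNorm_le_of_mem_rpowNormCone [ContinuousSMul 𝕜 E] [ContinuousSMul 𝕜 F] {r : ℝ}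
    (hr : 0 < r) {T : X.vectorValued normE → Y.vectorValued normF}
    (hThom : ∀ (c : ℝ≥0) (x : X.vectorValued normE),
      T (X.scale normE c x) = Y.scale normF c (T x))
    (hTineq : ∀ (n : ℕ) (x : Fin n → X.vectorValued normE),
      Y.eNorm (fun ω => (∑ k, normF ((T (x k) : Ω' →ₘ[ν] F) ω) ^ r) ^ (1 / r)) ≤
        X.eNorm (fun ω => (∑ k, normE ((x k : Ω →ₘ[μ] E) ω) ^ r) ^ (1 / r)))
    {t : (Ω → ℝ≥0) × (Ω' → ℝ≥0)} (ht : t ∈ rpowNormCone r T) :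
    Measurable t.1 ∧ Measurable t.2 ∧ X.powNorm r t.1 ≠ ∞ ∧
      Y.powNorm r t.2 ≤ X.powNorm r t.1 := by
  obtain ⟨n, g, hg, rfl⟩ := exists_sum_of_mem_span (smul_mem_rpowNormGraph hr hThom) ht
  choose h1 h2 x h3 h4 using hg
  rw [Prod.fst_sum, Prod.snd_sum]
  refine ⟨measurable_fin_sum h1, measurable_fin_sum h2,
    X.powNorm_sum_ne_top hr _ h1 fun k => powNorm_ne_top_of_vectorValued hr (x k).2 (h3 k), ?_⟩
  rw [← eNorm_rpow_sum_eq_powNorm h3, ← eNorm_rpow_sum_eq_powNorm h4]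
  exact ENNReal.rpow_le_rpow (hTineq n x) hr.le

end graph

/-- The pairs `(f, α)` such that `α` is the second entry of some `(g, α)` in `S` with `g ≤ h`
almost everywhere for some `(f, h)` in `R`. -/
def compCone {Ω Ω' : Type*} [MeasurableSpace Ω'] (ν : Measure Ω')
    (R : Submodule ℝ≥0 ((Ω → ℝ≥0) × (Ω' → ℝ≥0))) (S : Submodule ℝ≥0 ((Ω' → ℝ≥0) × ℝ≥0)) :
    Submodule ℝ≥0 ((Ω → ℝ≥0) × ℝ≥0) where
  carrier := {l | ∃ t ∈ R, ∃ s ∈ S, t.1 = l.1 ∧ s.2 = l.2 ∧ s.1 ≤ᵐ[ν] t.2}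
  zero_mem' := ⟨0, R.zero_mem, 0, S.zero_mem, rfl, rfl, by rfl⟩
  add_mem' := by
    rintro a b ⟨t, ht, s, hs, h1, h2, h3⟩ ⟨t', ht', s', hs', h1', h2', h3'⟩
    refine ⟨t + t', R.add_mem ht ht', s + s', S.add_mem hs hs', by simp [h1, h1'],
      by simp [h2, h2'], ?_⟩
    filter_upwards [h3, h3'] with ω h4 h5
    exact add_le_add h4 h5
  smul_mem' := by
    rintro c a ⟨t, ht, s, hs, h1, h2, h3⟩
    refine ⟨c • t, R.smul_mem c ht, c • s, S.smul_mem c hs, by simp [h1], by simp [h2], ?_⟩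
    filter_upwards [h3] with ω h4
    exact mul_le_mul_right h4 c

/-- The pairs `(g, ∫ f w)` with `(f, g)` in `R`. -/
def integralCone {Ω Ω' : Type*} [MeasurableSpace Ω] (μ : Measure Ω) {w : Ω → ℝ≥0}
    (hw : Measurable w) (R : Submodule ℝ≥0 ((Ω → ℝ≥0) × (Ω' → ℝ≥0)))
    (hR : ∀ t ∈ R, Measurable t.1) : Submodule ℝ≥0 ((Ω' → ℝ≥0) × ℝ≥0) where
  carrier := {u | ∃ t ∈ R, t.2 = u.1 ∧ ∫⁻ ω, t.1 ω * w ω ∂μ = u.2}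
  zero_mem' := ⟨0, R.zero_mem, rfl, by simp⟩
  add_mem' := by
    rintro a b ⟨t, ht, h1, h2⟩ ⟨t', ht', h1', h2'⟩
    refine ⟨t + t', R.add_mem ht ht', by simp [h1, h1'], ?_⟩
    rw [Prod.snd_add, ENNReal.coe_add, ← h2, ← h2', ← lintegral_add_left
      (f := fun ω => (t.1 ω : ℝ≥0∞) * w ω) ((hR t ht).coe_nnreal_ennreal.mul hw.coe_nnreal_ennreal)]
    simp [add_mul]
  smul_mem' := by
    rintro c a ⟨t, ht, h1, h2⟩
    refine ⟨c • t, R.smul_mem c ht, by simp [h1], ?_⟩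
    rw [Prod.smul_snd, smul_eq_mul, ENNReal.coe_mul, ← h2,
      ← lintegral_const_mul _ (f := fun ω => (t.1 ω : ℝ≥0∞) * w ω)
        ((hR t ht).coe_nnreal_ennreal.mul hw.coe_nnreal_ennreal)]
    simp [mul_assoc]

/-! ### The factorization theorem -/

theorem corollary8 {𝕜 Ω Ω' E F : Type*} [RCLike 𝕜]
    [MeasurableSpace Ω] (μ : Measure Ω) [SigmaFinite μ] [μ.IsComplete]
    [MeasurableSpace Ω'] (ν : Measure Ω') [SigmaFinite ν] [ν.IsComplete]
    [AddCommGroup E] [Module 𝕜 E] [TopologicalSpace E] [IsTopologicalAddGroup E]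
    [ContinuousSMul 𝕜 E] (normE : QuasiBanachNorm 𝕜 E)
    [AddCommGroup F] [Module 𝕜 F] [TopologicalSpace F] [IsTopologicalAddGroup F]
    [ContinuousSMul 𝕜 F] (normF : QuasiBanachNorm 𝕜 F)
    (X : QuasiBanachFunctionSpace μ) (Y : QuasiBanachFunctionSpace ν)
    (r : ℝ) (hr : 0 < r)
    (hXconv : X.IsRConvex r) (hXcont : X.IsSigmaOrderContinuous)
    (hYconc : Y.IsRConcave r)
    (T : X.vectorValued normE → Y.vectorValued normF)
    (hThom : ∀ (c : ℝ≥0) (x : X.vectorValued normE),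
      T (X.scale normE c x) = Y.scale normF c (T x))
    (hTineq : ∀ (n : ℕ) (x : Fin n → X.vectorValued normE),
      Y.eNorm (fun ω => (∑ k, normF ((T (x k) : Ω' →ₘ[ν] F) ω) ^ r) ^ (1 / r)) ≤
        X.eNorm (fun ω => (∑ k, normE ((x k : Ω →ₘ[μ] E) ω) ^ r) ^ (1 / r))) :
    ∃ (w₁ : Ω →ₘ[μ] ℝ) (w₂ : Ω' →ₘ[ν] ℝ), 0 ≤ w₁ ∧ 0 ≤ w₂ ∧
      (⨆ (x : X.carrier) (_ : X.qnorm x ≤ 1),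
        eLpNorm (fun ω => w₁ ω ^ (1 / r) * (x : Ω →ₘ[μ] ℝ) ω) (ENNReal.ofReal r) μ) ≤
          X.convexityConst r ∧
      (⨆ (y : Ω' →ₘ[ν] ℝ) (_ : eLpNorm y (ENNReal.ofReal r) ν ≤ 1),
        Y.eNorm (fun ω => w₂ ω ^ (1 / r) * y ω)) ≤ Y.concavityConst r ∧
      ∀ x : X.vectorValued normE,
        ∫⁻ ω, ENNReal.ofReal (normF ((T x : Ω' →ₘ[ν] F) ω) ^ r) / ENNReal.ofReal (w₂ ω) ∂ν ≤
          ∫⁻ ω, ENNReal.ofReal (normE ((x : Ω →ₘ[μ] E) ω) ^ r) * ENNReal.ofReal (w₁ ω) ∂μ := by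
  obtain ⟨M, hM, hM'⟩ := X.exists_convexWith_best hr hXconv
  obtain ⟨N, hN, hN'⟩ := Y.exists_concaveWith_best hr hYconc
  have hcone := fun t (ht : t ∈ rpowNormCone r T) =>
    powNorm_le_of_mem_rpowNormCone hr hThom hTineq ht
  set R := rpowNormCone r T with hR
  set S := Y.powNormCone r (N ^ r)⁻¹ with hS
  -- First sandwich. The lower cone remembers, for each (f, g) in R, the superadditive minorants
  -- N^{-r} ∑ p_Y(s_j) with ∑ s_j ≤ g, rather than only p_Y(g); this is what makes the second
  -- sandwich possible.
  obtain ⟨w, hwm, hwX, hwL⟩ := X.exists_weight_of_convexWith hr hM hXcont (compCone ν R S)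
    (by
      rintro l ⟨t, ht, s, hs, h1, h2, h3⟩
      rw [← h1]
      exact (hcone t ht).1)
    (by
      rintro l ⟨t, ht, s, hs, h1, h2, h3⟩
      rw [← h1, ← h2]
      exact ((Y.le_powNorm_of_mem_powNormCone hr hN hs).trans (Y.powNorm_mono hr
        (Y.measurable_of_mem_powNormCone hr hs) h3)).trans (hcone t ht).2.2.2)
  obtain ⟨w', hwm', hwY, hwU⟩ := Y.exists_weight_of_concaveWith hr hN
    (integralCone μ hwm R fun t ht => (hcone t ht).1)
    (by
      rintro u ⟨t, ht, h1, -⟩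
      rw [← h1]
      exact (hcone t ht).2.1)
    (by
      rintro u ⟨t, ht, h1, -⟩
      rw [← h1]
      exact ne_top_of_le_ne_top (hcone t ht).2.2.1 (hcone t ht).2.2.2)
    (by
      -- The compatibility condition of the second sandwich is the lower bound obtained for the
      -- first weight.
      rintro s hs u ⟨t, ht, h1, h2⟩ hsu
      rw [← h1] at hsu
      have := hwL (t.1, s.2) ⟨t, ht, s, hs, rfl, rfl, hsu⟩ (hcone t ht).2.2.1
      rw [h2] at this
      exact_mod_cast this)
  have hw₁ : AEStronglyMeasurable (fun ω => (w ω : ℝ)) μ :=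
    hwm.coe_nnreal_real.aestronglyMeasurable
  have hw₂ : AEStronglyMeasurable (fun ω => (w' ω : ℝ)) ν :=
    hwm'.coe_nnreal_real.aestronglyMeasurable
  refine ⟨AEEqFun.mk _ hw₁, AEEqFun.mk _ hw₂, ?_, ?_, ?_, ?_, ?_⟩
  · rw [← AEEqFun.coeFn_le]
    filter_upwards [AEEqFun.coeFn_zero (α := Ω) (β := ℝ) (μ := μ), AEEqFun.coeFn_mk _ hw₁]
      with ω h1 h2
    rw [h1, h2]
    exact NNReal.coe_nonneg _
  · rw [← AEEqFun.coeFn_le]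
    filter_upwards [AEEqFun.coeFn_zero (α := Ω') (β := ℝ) (μ := ν), AEEqFun.coeFn_mk _ hw₂]
      with ω h1 h2
    rw [h1, h2]
    exact NNReal.coe_nonneg _
  · rw [← hM']
    refine iSup₂_le fun x hx => ?_
    rw [← ENNReal.rpow_le_rpow_iff hr, eLpNorm_rpow_eq hr]
    have hxn : X.powNorm r (fun ω => (|(x : Ω →ₘ[μ] ℝ) ω| ^ r).toNNReal) ≤ 1 := by
      rw [X.powNorm_abs_rpow hr (x : Ω →ₘ[μ] ℝ).aestronglyMeasurable,
        X.eNorm_eq_of_ae_eq x ae_eq_rfl]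
      exact ENNReal.rpow_le_one (by simpa using hx) hr.le
    refine le_trans (le_of_eq (lintegral_congr_ae ?_))
      ((hwX _ ((x : Ω →ₘ[μ] ℝ).measurable.abs.pow_const r).real_toNNReal
        (ne_top_of_le_ne_top ENNReal.one_ne_top hxn)).trans (mul_le_of_le_one_right zero_le hxn))
    filter_upwards [AEEqFun.coeFn_mk _ hw₁] with ω h
    rw [h, coe_toNNReal_abs_rpow hr, enorm_mul, ENNReal.mul_rpow_of_nonneg _ _ hr.le, mul_comm]
    congr 1
    rw [← NNReal.coe_rpow, Real.enorm_eq_ofReal (NNReal.coe_nonneg _), ENNReal.ofReal_coe_nnreal,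
      ← ENNReal.coe_rpow_of_nonneg _ hr.le, ← NNReal.rpow_mul, one_div_mul_cancel hr.ne',
      NNReal.rpow_one]
  · rw [← hN']
    refine iSup₂_le fun y hy => ?_
    set h : Ω' → ℝ≥0 := fun ω => (|y ω| ^ r).toNNReal with hh
    have hhm : Measurable h := (y.measurable.abs.pow_const r).real_toNNReal
    have hint : ∫⁻ ω, h ω ∂ν ≤ 1 := by
      simp_rw [hh, coe_toNNReal_abs_rpow hr]
      rw [← eLpNorm_rpow_eq hr]
      exact ENNReal.rpow_le_one hy hr.le
    have hm : AEStronglyMeasurable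
        (fun ω => (AEEqFun.mk _ hw₂ : Ω' →ₘ[ν] ℝ) ω ^ (1 / r) * y ω) ν :=
      (((AEEqFun.mk _ hw₂ : Ω' →ₘ[ν] ℝ).measurable.pow_const _).mul
        y.measurable).aestronglyMeasurable
    rw [← Y.eNorm_abs hm, ← ENNReal.rpow_le_rpow_iff hr]
    refine le_trans (le_of_eq ?_) ((hwY h hhm (ne_top_of_le_ne_top ENNReal.one_ne_top hint)).trans
      (mul_le_of_le_one_right zero_le hint))
    rw [QuasiKotheSpace.powNorm]
    congr 1
    refine Y.eNorm_congr ?_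
    filter_upwards [AEEqFun.coeFn_mk _ hw₂] with ω h1
    rw [h1, Pi.mul_apply, NNReal.coe_mul, Real.mul_rpow (NNReal.coe_nonneg _)
      (NNReal.coe_nonneg _), hh, QuasiKotheSpace.coe_toNNReal_abs_rpow_rpow hr, abs_mul,
      abs_of_nonneg (by positivity)]
  · intro x
    obtain ⟨t, ht, h1, h2⟩ := exists_mem_rpowNormGraph r T x
    have htR : t ∈ R := Submodule.subset_span ht
    -- The cone on Y has finite second entries, so the integral must be finite before the pair can
    -- be formed.
    have hfin : ∫⁻ ω, t.1 ω * w ω ∂μ ≠ ∞ :=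
      ne_top_of_le_ne_top (ENNReal.mul_ne_top
        (ENNReal.rpow_ne_top_of_nonneg hr.le ENNReal.coe_ne_top) (hcone t htR).2.2.1)
        (hwX t.1 (hcone t htR).1 (hcone t htR).2.2.1)
    have key := hwU (t.2, (∫⁻ ω, t.1 ω * w ω ∂μ).toNNReal)
      ⟨t, htR, rfl, (ENNReal.coe_toNNReal hfin).symm⟩
    rw [ENNReal.coe_toNNReal hfin] at key
    refine le_trans (le_of_eq (lintegral_congr_ae ?_))
      (key.trans (le_of_eq (lintegral_congr_ae ?_)))
    · filter_upwards [h2, AEEqFun.coeFn_mk _ hw₂] with ω h3 h4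
      rw [← h3, h4, ENNReal.ofReal_coe_nnreal, ENNReal.ofReal_coe_nnreal]
    · filter_upwards [h1, AEEqFun.coeFn_mk _ hw₁] with ω h3 h4
      rw [← h3, h4, ENNReal.ofReal_coe_nnreal, ENNReal.ofReal_coe_nnreal]
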